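/- Let $W$ be a finite nonempty set and let $V:W^4\to\{0,1\}$, $(a,b,x,y)\mapsto V(a,b|x,y)$, be the predicate of a nonlocal game $\mathscr G$ with question and answer sets $W$. Assume that $\mathscr G$ is bisynchronous ($V(a,b|x,x)=0$ for $a\ne b$, and $V(a,a|x,y)=0$ for $x\neq y$) and transitive ($V(a,b|r,s)=V(r,s|x,y)=1$ implies $V(a,b|x,y)=1$), and that it has a perfect quantum strategy: there are finite-dimensional Hilbert spaces $H_A,H_B$, a unit vector $\psi\in H_A\otimes H_B$ and projection-valued measures $(P_{x,a})_{a\in W}$ on $H_A$ and $(Q_{y,b})_{b\in W}$ on $H_B$, for $x,y\in W$, such that $\langle (P_{x,a}\otimes Q_{y,b})\psi,\psi\rangle=0$ whenever $V(a,b|x,y)=0$. Let $C^*(\mathscr G)$ be the universal unital $C^*$-algebra generated by elements $u_{x,a}$ ($x,a\in W$) with the relations $u_{x,a}=u_{x,a}^*=u_{x,a}^2$, $\sum_a u_{x,a}=1$, and $u_{x,a}u_{y,b}=0$ if $V(a,b|x,y)=0$. For a complete directed graph $\Gamma$ on $W$ (one edge $(x,y)$ for each ordered pair with $x\neq y$)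 with labelled vertices and edges, let $C(\mathrm{Qut}(\Gamma))$ be the universal unital $C^*$-algebra generated by the entries of a magic unitary $v=[v_{x,a}]_{x,a\in W}$ that commutes with the adjacency matrix of the edges labelled $c$ and with the diagonal $0/1$ matrix of the vertices labelled $c$, for every label $c$. Then: 1. The relation $(x,y)\sim(a,b)\iff u_{x,a}u_{y,b}\neq 0$ (with the product taken in $C^*(\mathscr G)$) is an equivalence relation on $W\times W$. Its classes are the orbitals of $C^*(\mathscr G)$. 2. Let $\Gamma$ be the complete directed graph on $W$ in which the edge $(x,y)$, $x\ne y$, is labelled by the orbital of $(x,y)$ and the vertex $x$ is labelled by the orbital of $(x,x)$. There are unital $*$-homomorphisms $\Delta:C^*(\mathscr G)\to C^*(\mathscr G)\otimes_{\min}C^*(\mathscr G)$ and $\Delta':C(\mathrm{Qut}(\Gamma))\to C(\mathrm{Qut}(\Gamma))\otimes_{\min}C(\mathrm{Qut}(\Gamma))$ with $\Delta(u_{x,a})=\sum_{r}u_{x,r}\otimes u_{r,a}$ and $\Delta'(v_{x,a})=\sum_r v_{x,r}\otimes v_{r,a}$ that make both algebras compact quantum groups. There is a $*$-isomorphism $\varphi:C^*(\mathscr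 G)\to C(\mathrm{Qut}(\Gamma))$ with $\varphi(u_{x,a})=v_{x,a}$ for all $x,a\in W$ and $(\varphi\otimes\varphi)\Delta=\Delta'\varphi$. In other words, $(C^*(\mathscr G),\Delta)$ is isomorphic to the quantum automorphism group $\mathrm{Qut}(\Gamma)$. -/

import Mathlib

universe u

noncomputable section

open scoped TensorProduct

/-! ## C*-seminorms and their C*-completions -/

/-- A submultiplicative seminorm with `p (a* a) = p a ^ 2` on a unital complex *-algebra. -/
structure CStarSeminorm (F : Type*) [Ring F] [StarRing F] [Algebra ℂ F] extends
    Seminorm ℂ F where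
  mul_le' : ∀ a b, toFun (a * b) ≤ toFun a * toFun b
  star_mul_self' : ∀ a, toFun (star a * a) = toFun a * toFun a

namespace CStarSeminorm

variable {F : Type*} [Ring F] [StarRing F] [Algebra ℂ F]

/-- The value of the seminorm. -/
def val (p : CStarSeminorm F) (a : F) : ℝ := p.toFun a

theorem val_nonneg (p : CStarSeminorm F) (a : F) : 0 ≤ p.val a := apply_nonneg p.toSeminorm a

theorem val_zero (p : CStarSeminorm F) : p.val 0 = 0 := map_zero p.toSeminorm

theorem val_add_le (p : CStarSeminorm F) (a b : F) : p.val (a + b) ≤ p.val a + p.val b :=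
  p.add_le' a b

theorem val_neg (p : CStarSeminorm F) (a : F) : p.val (-a) = p.val a := p.neg' a

theorem val_smul (p : CStarSeminorm F) (c : ℂ) (a : F) : p.val (c • a) = ‖c‖ * p.val a :=
  p.smul' c a

theorem val_mul_le (p : CStarSeminorm F) (a b : F) : p.val (a * b) ≤ p.val a * p.val b :=
  p.mul_le' a b

theorem val_star_mul_self (p : CStarSeminorm F) (a : F) :
    p.val (star a * a) = p.val a * p.val a :=
  p.star_mul_self' a

theorem val_le_star (p : CStarSeminorm F) (a : F) : p.val a ≤ p.val (star a) := by
  rcases (p.val_nonneg a).eq_or_lt with h | h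
  · rw [← h]; exact p.val_nonneg _
  · have h1 := p.val_mul_le (star a) a
    rw [p.val_star_mul_self] at h1
    exact le_of_mul_le_mul_right h1 h

theorem val_star (p : CStarSeminorm F) (a : F) : p.val (star a) = p.val a :=
  le_antisymm (by simpa using p.val_le_star (star a)) (p.val_le_star a)

/-- Pointwise supremum of a pointwise bounded family of C*-seminorms. -/
def sup {ι : Sort*} (p : ι → CStarSeminorm F)
    (hp : ∀ a, BddAbove (Set.range fun i => (p i).val a)) : CStarSeminorm F where
  toFun a := ⨆ i, (p i).val a
  map_zero' := by simp [val_zero]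
  add_le' a b := by
    have h0 : ∀ c, 0 ≤ ⨆ i, (p i).val c := fun c => Real.iSup_nonneg fun i => (p i).val_nonneg c
    refine Real.iSup_le (fun i => ?_) (add_nonneg (h0 a) (h0 b))
    exact ((p i).val_add_le a b).trans (add_le_add (le_ciSup (hp a) i) (le_ciSup (hp b) i))
  neg' a := by simp [val_neg]
  smul' c a := by
    simp only [val_smul]
    exact (Real.mul_iSup_of_nonneg (norm_nonneg c) _).symm
  mul_le' a b := by
    have h0 : ∀ c, 0 ≤ ⨆ i, (p i).val c := fun c => Real.iSup_nonneg fun i => (p i).val_nonneg c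
    refine Real.iSup_le (fun i => ?_) (mul_nonneg (h0 a) (h0 b))
    exact ((p i).val_mul_le a b).trans
      (mul_le_mul (le_ciSup (hp a) i) (le_ciSup (hp b) i) ((p i).val_nonneg b) (h0 a))
  star_mul_self' a := by
    have h0 : ∀ c, 0 ≤ ⨆ i, (p i).val c := fun c => Real.iSup_nonneg fun i => (p i).val_nonneg c
    apply le_antisymm
    · refine Real.iSup_le (fun i => ?_) (mul_nonneg (h0 a) (h0 a))
      rw [val_star_mul_self]
      exact mul_le_mul (le_ciSup (hp a) i) (le_ciSup (hp a) i) ((p i).val_nonneg a) (h0 a)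
    · have h1 : ∀ i, (p i).val a ≤ Real.sqrt (⨆ i, (p i).val (star a * a)) := fun i => by
        apply Real.le_sqrt_of_sq_le
        rw [pow_two, ← val_star_mul_self]
        exact le_ciSup (hp (star a * a)) i
      have h2 : (⨆ i, (p i).val a) ≤ Real.sqrt (⨆ i, (p i).val (star a * a)) :=
        Real.iSup_le h1 (Real.sqrt_nonneg _)
      calc _ ≤ Real.sqrt (⨆ i, (p i).val (star a * a)) *
            Real.sqrt (⨆ i, (p i).val (star a * a)) :=
            mul_le_mul h2 h2 (h0 a) (Real.sqrt_nonneg _)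
        _ = _ := Real.mul_self_sqrt (h0 _)

/-- The *-algebra `F`, seminormed by `p`. -/
@[nolint unusedArguments]
def Pre (_p : CStarSeminorm F) : Type _ := F

namespace Pre

variable (p : CStarSeminorm F)

instance : Ring p.Pre := inferInstanceAs (Ring F)
instance : StarRing p.Pre := inferInstanceAs (StarRing F)
instance : Algebra ℂ p.Pre := inferInstanceAs (Algebra ℂ F)
instance [StarModule ℂ F] : StarModule ℂ p.Pre := inferInstanceAs (StarModule ℂ F)

instance : Norm p.Pre := ⟨p.val⟩

theorem norm_def (a : p.Pre) : ‖a‖ = p.val a := rfl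

instance : SeminormedRing p.Pre where
  __ := (inferInstance : Ring p.Pre)
  __ := SeminormedAddCommGroup.ofCore (𝕜 := ℂ) (E := p.Pre)
    { norm_nonneg := p.val_nonneg
      norm_smul := p.val_smul
      norm_triangle := p.val_add_le }
  norm_mul_le := p.val_mul_le

instance : NormedAlgebra ℂ p.Pre where
  norm_smul_le c a := (p.val_smul c a).le

instance : NormedStarGroup p.Pre where
  norm_star_le a := (p.val_star a).le

theorem norm_star_mul_self (a : p.Pre) : ‖star a * a‖ = ‖a‖ * ‖a‖ := p.val_star_mul_self a

theorem uniformContinuous_star : UniformContinuous (star : p.Pre → p.Pre) :=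
  star_isometry.uniformContinuous

end Pre

open UniformSpace

/-- The C*-algebra obtained from `F` by dividing out the null space of `p` and completing. -/
def CStarCompletion (p : CStarSeminorm F) : Type _ := Completion p.Pre

namespace CStarCompletion

variable (p : CStarSeminorm F)

instance : NormedRing p.CStarCompletion := (inferInstance : NormedRing (Completion p.Pre))
instance : CompleteSpace p.CStarCompletion := (inferInstance : CompleteSpace (Completion p.Pre))
instance : NormedAlgebra ℂ p.CStarCompletion where
  __ := (inferInstance : Algebra ℂ (Completion p.Pre))
  norm_smul_le := norm_smul_le (α := ℂ) (β := Completion p.Pre)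

/-- The canonical map of `F` into its completion. -/
def of : F →ₐ[ℂ] p.CStarCompletion where
  toFun a := ((show p.Pre from a : p.Pre) : Completion p.Pre)
  map_one' := rfl
  map_mul' a b := Completion.coe_mul (α := p.Pre) a b
  map_zero' := rfl
  map_add' a b := Completion.coe_add (α := p.Pre) a b
  commutes' _ := rfl

theorem norm_of (a : F) : ‖of p a‖ = p.val a := Completion.norm_coe (E := p.Pre) a

theorem denseRange_of : DenseRange (of p) := Completion.denseRange_coe (α := p.Pre)

theorem induction_of {P : p.CStarCompletion → Prop} (hc : IsClosed {x | P x})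
    (h : ∀ a, P (of p a)) (x : p.CStarCompletion) : P x :=
  isClosed_property (denseRange_of p) hc h x

instance : Star p.CStarCompletion := ⟨Completion.map (star : p.Pre → p.Pre)⟩

theorem star_of (a : F) : star (of p a) = of p (star a) :=
  Completion.map_coe (Pre.uniformContinuous_star p) a

instance : ContinuousStar p.CStarCompletion := ⟨Completion.continuous_map⟩

instance : StarRing p.CStarCompletion where
  star_involutive := by
    refine induction_of p (isClosed_eq (by fun_prop) (by fun_prop)) fun a => ?_
    rw [star_of, star_of, star_star]
  star_mul x y := by
    refine induction_of p (P := fun x => star (x * y) = star y * star x)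
      (isClosed_eq (by fun_prop) (by fun_prop)) (fun a => ?_) x
    refine induction_of p (P := fun y => star (of p a * y) = star y * star (of p a))
      (isClosed_eq (by fun_prop) (by fun_prop)) (fun b => ?_) y
    rw [← map_mul, star_of, star_of, star_of, star_mul, map_mul]
  star_add x y := by
    refine induction_of p (P := fun x => star (x + y) = star x + star y)
      (isClosed_eq (by fun_prop) (by fun_prop)) (fun a => ?_) x
    refine induction_of p (P := fun y => star (of p a + y) = star (of p a) + star y)
      (isClosed_eq (by fun_prop) (by fun_prop)) (fun b => ?_) y
    rw [← map_add, star_of, star_of, star_of, star_add, map_add]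

instance [StarModule ℂ F] : StarModule ℂ p.CStarCompletion where
  star_smul c := by
    refine induction_of p (isClosed_eq (continuous_star.comp (continuous_const_smul c))
      (continuous_star.const_smul (star c))) fun a => ?_
    rw [← map_smul, star_of, star_of, star_smul, map_smul]

instance : CStarRing p.CStarCompletion where
  norm_mul_self_le := by
    refine induction_of p (isClosed_le (by fun_prop) (by fun_prop)) fun a => ?_
    rw [star_of, ← map_mul, norm_of, norm_of, val_star_mul_self]

instance [StarModule ℂ F] : CStarAlgebra p.CStarCompletion where
  star_add := star_add
  norm_mul_self_le := CStarRing.norm_mul_self_le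

section lift

variable {B : Type*} [CStarAlgebra B] (f : F →⋆ₐ[ℂ] B)

theorem continuous_pre (hf : ∀ a, ‖f a‖ ≤ p.val a) : Continuous (show p.Pre →+* B from (f : F →+* B)) := by
  refine AddMonoidHomClass.continuous_of_bound (show p.Pre →+* B from (f : F →+* B)) 1 fun a => ?_
  rw [one_mul]
  exact hf a

/-- The extension of a dominated *-homomorphism, as a ring homomorphism. -/
def liftRingHom (hf : ∀ a, ‖f a‖ ≤ p.val a) : p.CStarCompletion →+* B :=
  Completion.extensionHom (show p.Pre →+* B from (f : F →+* B)) (continuous_pre p f hf)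

theorem liftRingHom_of (hf : ∀ a, ‖f a‖ ≤ p.val a) (a : F) : liftRingHom p f hf (of p a) = f a :=
  Completion.extensionHom_coe (α := p.Pre) _ (continuous_pre p f hf) a

theorem continuous_liftRingHom (hf : ∀ a, ‖f a‖ ≤ p.val a) : Continuous (liftRingHom p f hf) :=
  Completion.continuous_extension

/-- A *-homomorphism on `F` into a C*-algebra which is dominated by `p` extends to the
completion. -/
def lift [StarModule ℂ F] (hf : ∀ a, ‖f a‖ ≤ p.val a) : p.CStarCompletion →⋆ₐ[ℂ] B where
  __ := liftRingHom p f hf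
  commutes' c := by
    change liftRingHom p f hf _ = _
    rw [← (of p).commutes c, liftRingHom_of]
    exact AlgHomClass.commutes f c
  map_star' := by
    change ∀ x, liftRingHom p f hf (star x) = star (liftRingHom p f hf x)
    have h := continuous_liftRingHom p f hf
    refine induction_of p (isClosed_eq (by fun_prop) (by fun_prop)) fun a => ?_
    rw [star_of, liftRingHom_of, liftRingHom_of, map_star]

theorem lift_of [StarModule ℂ F] (hf : ∀ a, ‖f a‖ ≤ p.val a) (a : F) : lift p f hf (of p a) = f a := liftRingHom_of p f hf a

end lift

end CStarCompletion
end CStarSeminorm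

/-! ## Free *-algebras and universal C*-algebras -/

/-- The free unital complex *-algebra on `X`: the free algebra on the letters `x = inl x` and
`x* = inr x`. -/
def FreeStarAlgebra (X : Type u) : Type u := FreeAlgebra ℂ (X ⊕ X)

namespace FreeStarAlgebra

variable {X : Type u}

instance : Ring (FreeStarAlgebra X) := (inferInstance : Ring (FreeAlgebra ℂ (X ⊕ X)))
instance : Algebra ℂ (FreeStarAlgebra X) :=
  (inferInstance : Algebra ℂ (FreeAlgebra ℂ (X ⊕ X)))

/-- The letters `x` and `x*`. -/
def letter (y : X ⊕ X) : FreeStarAlgebra X := FreeAlgebra.ι ℂ y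

/-- The generator `x`. -/
def gen (x : X) : FreeStarAlgebra X := letter (.inl x)

theorem induction {P : FreeStarAlgebra X → Prop} (h1 : ∀ c : ℂ, P (algebraMap ℂ _ c))
    (hl : ∀ y, P (letter y)) (hm : ∀ a b, P a → P b → P (a * b))
    (ha : ∀ a b, P a → P b → P (a + b)) (a : FreeStarAlgebra X) : P a :=
  FreeAlgebra.induction (motive := P) _ _ h1 hl hm ha a

/-- The algebra homomorphism prescribed on the letters. -/
def liftLetters {B : Type*} [Ring B] [Algebra ℂ B] (f : X ⊕ X → B) : FreeStarAlgebra X →ₐ[ℂ] B :=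
  FreeAlgebra.lift ℂ f

theorem liftLetters_letter {B : Type*} [Ring B] [Algebra ℂ B] (f : X ⊕ X → B) (y : X ⊕ X) :
    liftLetters f (letter y) = f y :=
  FreeAlgebra.lift_ι_apply f y

/-- The opposite algebra, with complex conjugate scalar multiplication. -/
abbrev conjOp (X : Type u) : Algebra ℂ (FreeStarAlgebra X)ᵐᵒᵖ :=
  ((algebraMap ℂ (FreeStarAlgebra X)ᵐᵒᵖ).comp (starRingEnd ℂ)).toAlgebra'
    fun c a => Algebra.commutes (A := (FreeStarAlgebra X)ᵐᵒᵖ) (starRingEnd ℂ c) a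

/-- The conjugate-linear anti-automorphism exchanging `x` and `x*`. -/
def starHom : FreeStarAlgebra X →+* (FreeStarAlgebra X)ᵐᵒᵖ :=
  letI := conjOp X
  (liftLetters fun y => MulOpposite.op (letter y.swap)).toRingHom

theorem starHom_algebraMap (c : ℂ) :
    starHom (algebraMap ℂ (FreeStarAlgebra X) c) =
      MulOpposite.op (algebraMap ℂ (FreeStarAlgebra X) (star c)) :=
  letI := conjOp X
  (liftLetters fun y : X ⊕ X => MulOpposite.op (letter y.swap)).commutes c

theorem starHom_letter (y : X ⊕ X) : starHom (letter y) = MulOpposite.op (letter y.swap) :=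
  letI := conjOp X
  liftLetters_letter _ y

instance : StarRing (FreeStarAlgebra X) where
  star a := (starHom a).unop
  star_involutive a := by
    change (starHom (starHom a).unop).unop = a
    induction a using induction with
    | h1 c =>
      rw [starHom_algebraMap, MulOpposite.unop_op, starHom_algebraMap, star_star,
        MulOpposite.unop_op]
    | hl y =>
      rw [starHom_letter, MulOpposite.unop_op, starHom_letter, Sum.swap_swap, MulOpposite.unop_op]
    | ha a b iha ihb => simp [iha, ihb]
    | hm a b iha ihb => simp [iha, ihb]
  star_mul a b := by simp
  star_add a b := by simp

theorem star_letter (y : X ⊕ X) : star (letter y) = letter y.swap :=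
  congrArg MulOpposite.unop (starHom_letter y)

theorem star_algebraMap' (c : ℂ) :
    star (algebraMap ℂ (FreeStarAlgebra X) c) = algebraMap ℂ _ (star c) :=
  congrArg MulOpposite.unop (starHom_algebraMap c)

instance : StarModule ℂ (FreeStarAlgebra X) where
  star_smul c a := by
    rw [Algebra.smul_def, star_mul, star_algebraMap', ← Algebra.commutes, ← Algebra.smul_def]

/-- The *-homomorphism prescribed on the generators. -/
def lift {B : Type*} [Ring B] [StarRing B] [Algebra ℂ B] [StarModule ℂ B] (f : X → B) :
    FreeStarAlgebra X →⋆ₐ[ℂ] B where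
  __ := liftLetters (Sum.elim f fun x => star (f x))
  map_star' a := by
    change liftLetters _ _ = star (liftLetters _ _)
    induction a using induction with
    | h1 c => rw [star_algebraMap', AlgHom.commutes, AlgHom.commutes, algebraMap_star_comm]
    | hl y => cases y <;> simp [star_letter, liftLetters_letter]
    | ha a b iha ihb => simp [iha, ihb]
    | hm a b iha ihb => simp [iha, ihb]

theorem lift_gen {B : Type*} [Ring B] [StarRing B] [Algebra ℂ B] [StarModule ℂ B] (f : X → B)
    (x : X) : lift f (gen x) = f x :=
  liftLetters_letter _ _

end FreeStarAlgebra

/-- The C*-seminorm `a ↦ ‖π a‖` of a *-homomorphism into a C*-algebra. -/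
def CStarSeminorm.ofHom {F : Type*} [Ring F] [StarRing F] [Algebra ℂ F] {B : Type*}
    [CStarAlgebra B] (f : F →⋆ₐ[ℂ] B) : CStarSeminorm F where
  toFun a := ‖f a‖
  map_zero' := by simp
  add_le' a b := by rw [map_add]; exact norm_add_le _ _
  neg' a := by rw [map_neg, norm_neg]
  smul' c a := by rw [map_smul, norm_smul]
  mul_le' a b := by rw [map_mul]; exact norm_mul_le _ _
  star_mul_self' a := by rw [map_mul, map_star, CStarRing.norm_star_mul_self]

/-- Relations on a set `X` of generators: a property of families of bounded operators on complex
Hilbert spaces which forces each of the operators to be bounded by a constant. -/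
structure CStarRelations (X : Type u) where
  /-- The operators `T x` satisfy the relations. -/
  Holds : ∀ (H : Type u) [NormedAddCommGroup H] [InnerProductSpace ℂ H] [CompleteSpace H],
    (X → H →L[ℂ] H) → Prop
  bounded : ∀ x, ∃ C : ℝ, ∀ (H : Type u) [NormedAddCommGroup H] [InnerProductSpace ℂ H]
    [CompleteSpace H] (T : X → H →L[ℂ] H), Holds H T → ‖T x‖ ≤ C

namespace CStarRelations

variable {X : Type u} (R : CStarRelations X)

/-- A representation of the relations on a Hilbert space. -/
structure Rep where
  /-- The Hilbert space. -/
  H : Type u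
  [normed : NormedAddCommGroup H]
  [inner : InnerProductSpace ℂ H]
  [complete : CompleteSpace H]
  /-- The operators. -/
  T : X → H →L[ℂ] H
  holds : R.Holds H T

attribute [instance] Rep.normed Rep.inner Rep.complete

theorem bddAbove (a : FreeStarAlgebra X) :
    BddAbove (Set.range fun r : R.Rep => (CStarSeminorm.ofHom (FreeStarAlgebra.lift r.T)).val a) := by
  suffices h : ∃ C : ℝ, 0 ≤ C ∧ ∀ r : R.Rep, ‖FreeStarAlgebra.lift r.T a‖ ≤ C by
    obtain ⟨C, -, h⟩ := h
    exact ⟨C, by rintro _ ⟨r, rfl⟩; exact h r⟩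
  induction a using FreeStarAlgebra.induction with
  | h1 c =>
    refine ⟨‖c‖, norm_nonneg c, fun r => ?_⟩
    rw [AlgHomClass.commutes, Algebra.algebraMap_eq_smul_one, norm_smul]
    exact mul_le_of_le_one_right (norm_nonneg c) ContinuousLinearMap.norm_id_le
  | hl y =>
    have h : ∀ x, ∃ C : ℝ, 0 ≤ C ∧ ∀ r : R.Rep, ‖r.T x‖ ≤ C := fun x => by
      obtain ⟨C, h⟩ := R.bounded x
      exact ⟨max C 0, le_max_right _ _, fun r => (h r.H r.T r.holds).trans (le_max_left _ _)⟩
    cases y with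
    | inl x =>
      obtain ⟨C, hC, h⟩ := h x
      exact ⟨C, hC, fun r => (congrArg norm (FreeStarAlgebra.lift_gen r.T x)).trans_le (h r)⟩
    | inr x =>
      obtain ⟨C, hC, h⟩ := h x
      refine ⟨C, hC, fun r => ?_⟩
      have e : (FreeStarAlgebra.letter (.inr x) : FreeStarAlgebra X) =
          star (FreeStarAlgebra.gen x) :=
        (FreeStarAlgebra.star_letter (.inl x)).symm
      rw [e, map_star, norm_star, FreeStarAlgebra.lift_gen]
      exact h r
  | ha a b iha ihb =>
    obtain ⟨C, hC, h⟩ := iha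
    obtain ⟨D, hD, h'⟩ := ihb
    refine ⟨C + D, add_nonneg hC hD, fun r => ?_⟩
    rw [map_add]
    exact (norm_add_le _ _).trans (add_le_add (h r) (h' r))
  | hm a b iha ihb =>
    obtain ⟨C, hC, h⟩ := iha
    obtain ⟨D, hD, h'⟩ := ihb
    refine ⟨C * D, mul_nonneg hC hD, fun r => ?_⟩
    rw [map_mul]
    exact (norm_mul_le _ _).trans (mul_le_mul (h r) (h' r) (norm_nonneg _) hC)

/-- The seminorm `‖a‖ = sup ‖π a‖`, the supremum over all representations of the relations. -/
def seminorm : CStarSeminorm (FreeStarAlgebra X) :=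
  .sup (fun r : R.Rep => .ofHom (FreeStarAlgebra.lift r.T)) R.bddAbove

/-- The universal unital C*-algebra generated by `X` with the given relations. -/
def Universal : Type u := R.seminorm.CStarCompletion

instance : CStarAlgebra R.Universal := (inferInstance : CStarAlgebra R.seminorm.CStarCompletion)

/-- The canonical generators of the universal C*-algebra. -/
def gen (x : X) : R.Universal := CStarSeminorm.CStarCompletion.of _ (FreeStarAlgebra.gen x)

end CStarRelations

/-! ## The minimal tensor product -/

/-- The Hilbert space tensor product: the completion of the algebraic tensor product with respect
to the inner product with `⟨x ⊗ y, x' ⊗ y'⟩ = ⟨x, x'⟩ ⟨y, y'⟩`. -/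
def HilbertTensor (H K : Type u) [NormedAddCommGroup H] [InnerProductSpace ℂ H]
    [NormedAddCommGroup K] [InnerProductSpace ℂ K] : Type u :=
  UniformSpace.Completion (H ⊗[ℂ] K)

namespace HilbertTensor

open UniformSpace

variable {H K : Type u} [NormedAddCommGroup H] [InnerProductSpace ℂ H] [NormedAddCommGroup K]
  [InnerProductSpace ℂ K]

instance : NormedAddCommGroup (HilbertTensor H K) :=
  (inferInstance : NormedAddCommGroup (Completion (H ⊗[ℂ] K)))
instance : InnerProductSpace ℂ (HilbertTensor H K) :=
  (inferInstance : InnerProductSpace ℂ (Completion (H ⊗[ℂ] K)))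
instance : CompleteSpace (HilbertTensor H K) :=
  (inferInstance : CompleteSpace (Completion (H ⊗[ℂ] K)))

/-- The canonical map from the algebraic tensor product. -/
def of : H ⊗[ℂ] K →ₗ[ℂ] HilbertTensor H K :=
  (Completion.toComplₗᵢ : H ⊗[ℂ] K →ₗᵢ[ℂ] Completion (H ⊗[ℂ] K)).toLinearMap

theorem denseRange_of : DenseRange (of : H ⊗[ℂ] K → HilbertTensor H K) :=
  Completion.denseRange_coe (α := H ⊗[ℂ] K)

theorem inner_of (x y : H ⊗[ℂ] K) : inner ℂ (of x) (of y) = inner ℂ x y :=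
  Completion.inner_coe (𝕜 := ℂ) (E := H ⊗[ℂ] K) x y

theorem clm_ext {F : Type*} [NormedAddCommGroup F] [NormedSpace ℂ F]
    {f g : HilbertTensor H K →L[ℂ] F} (h : ∀ x y, f (of (x ⊗ₜ y)) = g (of (x ⊗ₜ y))) : f = g := by
  refine ContinuousLinearMap.coeFn_injective (denseRange_of.equalizer f.continuous g.continuous ?_)
  funext z
  induction z using TensorProduct.induction_on with
  | zero => simp
  | add z w hz hw =>
    simp only [Function.comp_apply] at hz hw ⊢
    rw [map_add, map_add, map_add, hz, hw]
  | tmul x y => exact h x y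

/-- The operator `S ⊗ T` on the Hilbert space tensor product. -/
def map (S : H →L[ℂ] H) (T : K →L[ℂ] K) : HilbertTensor H K →L[ℂ] HilbertTensor H K :=
  (TensorProduct.mapL S T).completion

theorem map_of (S : H →L[ℂ] H) (T : K →L[ℂ] K) (z : H ⊗[ℂ] K) :
    map S T (of z) = of (TensorProduct.mapL S T z) :=
  ContinuousLinearMap.completion_apply_coe (TensorProduct.mapL S T) z

theorem map_tmul (S : H →L[ℂ] H) (T : K →L[ℂ] K) (x : H) (y : K) :
    map S T (of (x ⊗ₜ y)) = of (S x ⊗ₜ T y) := by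
  rw [map_of]; rfl

theorem norm_map_le (S : H →L[ℂ] H) (T : K →L[ℂ] K) : ‖map S T‖ ≤ ‖S‖ * ‖T‖ := by
  refine ContinuousLinearMap.opNorm_le_bound _ (by positivity) fun z => ?_
  refine isClosed_property denseRange_of (p := fun z => ‖map S T z‖ ≤ ‖S‖ * ‖T‖ * ‖z‖)
    (isClosed_le (by fun_prop) (by fun_prop)) (fun w => ?_) z
  rw [map_of]
  refine (Completion.norm_coe (E := H ⊗[ℂ] K) _).trans_le ?_
  refine ((TensorProduct.mapL S T).le_opNorm w).trans ?_
  refine (mul_le_mul_of_nonneg_right (TensorProduct.norm_mapL_le S T) (norm_nonneg _)).trans ?_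
  exact le_of_eq (congrArg _ (Completion.norm_coe (E := H ⊗[ℂ] K) w).symm)

theorem inner_map_left [CompleteSpace H] [CompleteSpace K] (S : H →L[ℂ] H) (T : K →L[ℂ] K)
    (z w : HilbertTensor H K) : inner ℂ (map (star S) (star T) z) w = inner ℂ z (map S T w) := by
  refine isClosed_property denseRange_of
    (p := fun z => inner ℂ (map (star S) (star T) z) w = inner ℂ z (map S T w))
    (isClosed_eq (by fun_prop) (by fun_prop)) (fun x => ?_) z
  refine isClosed_property denseRange_of
    (p := fun w => inner ℂ (map (star S) (star T) (of x)) w = inner ℂ (of x) (map S T w))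
    (isClosed_eq (by fun_prop) (by fun_prop)) (fun y => ?_) w
  rw [map_of, map_of, inner_of, inner_of]
  induction x using TensorProduct.induction_on with
  | zero => simp
  | add x x' hx hx' => rw [map_add, inner_add_left, inner_add_left, hx, hx']
  | tmul x x' =>
    induction y using TensorProduct.induction_on with
    | zero => simp
    | add y y' hy hy' => rw [map_add, inner_add_right, inner_add_right, hy, hy']
    | tmul y y' => simp [ContinuousLinearMap.star_eq_adjoint, ContinuousLinearMap.adjoint_inner_left]

theorem star_map [CompleteSpace H] [CompleteSpace K] (S : H →L[ℂ] H) (T : K →L[ℂ] K) :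
    star (map S T) = map (star S) (star T) :=
  ((ContinuousLinearMap.eq_adjoint_iff _ _).mpr (inner_map_left S T)).symm

end HilbertTensor

namespace MinTensor

variable {A B C D : Type u} [CStarAlgebra A] [CStarAlgebra B] [CStarAlgebra C] [CStarAlgebra D]

/-- A representation of a C*-algebra on a Hilbert space. -/
structure Rep (A : Type u) [CStarAlgebra A] where
  /-- The Hilbert space. -/
  H : Type u
  [normed : NormedAddCommGroup H]
  [inner : InnerProductSpace ℂ H]
  [complete : CompleteSpace H]
  /-- The *-homomorphism. -/
  hom : A →⋆ₐ[ℂ] (H →L[ℂ] H)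

attribute [instance] Rep.normed Rep.inner Rep.complete

variable {H K : Type u} [NormedAddCommGroup H] [InnerProductSpace ℂ H] [CompleteSpace H]
  [NormedAddCommGroup K] [InnerProductSpace ℂ K] [CompleteSpace K]

/-- The representation `π ⊗ σ` of the algebraic tensor product on the Hilbert space tensor
product, determined by `(π ⊗ σ)(a ⊗ b) = π a ⊗ σ b`. -/
def tensorHom (π : A →⋆ₐ[ℂ] (H →L[ℂ] H)) (σ : B →⋆ₐ[ℂ] (K →L[ℂ] K)) :
    A ⊗[ℂ] B →⋆ₐ[ℂ] (HilbertTensor H K →L[ℂ] HilbertTensor H K) :=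
  let L : A ⊗[ℂ] B →ₗ[ℂ] (HilbertTensor H K →L[ℂ] HilbertTensor H K) :=
    TensorProduct.lift (LinearMap.mk₂ ℂ (fun a b => HilbertTensor.map (π a) (σ b))
      (fun a a' b => HilbertTensor.clm_ext fun x y => by
        simp [HilbertTensor.map_tmul, TensorProduct.add_tmul])
      (fun c a b => HilbertTensor.clm_ext fun x y => by
        simp [HilbertTensor.map_tmul, ← TensorProduct.smul_tmul'])
      (fun a b b' => HilbertTensor.clm_ext fun x y => by
        simp [HilbertTensor.map_tmul, TensorProduct.tmul_add])
      (fun c a b => HilbertTensor.clm_ext fun x y => by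
        simp [HilbertTensor.map_tmul]))
  { Algebra.TensorProduct.algHomOfLinearMapTensorProduct L
      (fun a a' b b' => HilbertTensor.clm_ext fun x y => by
        simp [L, HilbertTensor.map_tmul])
      (HilbertTensor.clm_ext fun x y => by
        simp [L, HilbertTensor.map_tmul]) with
    map_star' := fun t => by
      change L (star t) = star (L t)
      induction t using TensorProduct.induction_on with
      | zero => simp
      | add s t hs ht => rw [star_add, map_add, hs, ht, map_add, star_add]
      | tmul a b =>
        simp only [L, TensorProduct.star_tmul, TensorProduct.lift.tmul, LinearMap.mk₂_apply,
          HilbertTensor.star_map, map_star] }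

theorem tensorHom_tmul (π : A →⋆ₐ[ℂ] (H →L[ℂ] H)) (σ : B →⋆ₐ[ℂ] (K →L[ℂ] K)) (a : A) (b : B) :
    tensorHom π σ (a ⊗ₜ b) = HilbertTensor.map (π a) (σ b) :=
  rfl

theorem tensorHom_comp (π : C →⋆ₐ[ℂ] (H →L[ℂ] H)) (σ : D →⋆ₐ[ℂ] (K →L[ℂ] K)) (f : A →⋆ₐ[ℂ] C)
    (g : B →⋆ₐ[ℂ] D) (t : A ⊗[ℂ] B) :
    tensorHom π σ (Algebra.TensorProduct.map (f : A →ₐ[ℂ] C) (g : B →ₐ[ℂ] D) t) =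
      tensorHom (π.comp f) (σ.comp g) t := by
  induction t using TensorProduct.induction_on with
  | zero => rw [map_zero, map_zero, map_zero]
  | add s t hs ht => rw [map_add, map_add, map_add, hs, ht]
  | tmul a b =>
    rw [Algebra.TensorProduct.map_tmul, tensorHom_tmul, tensorHom_tmul]
    rfl

theorem bddAbove (t : A ⊗[ℂ] B) :
    BddAbove (Set.range fun r : Rep A × Rep B =>
      (CStarSeminorm.ofHom (tensorHom r.1.hom r.2.hom)).val t) := by
  suffices h : ∃ C : ℝ, ∀ (π : Rep A) (σ : Rep B), ‖tensorHom π.hom σ.hom t‖ ≤ C by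
    obtain ⟨C, h⟩ := h
    exact ⟨C, by rintro _ ⟨r, rfl⟩; exact h r.1 r.2⟩
  induction t using TensorProduct.induction_on with
  | zero => exact ⟨0, fun π σ => by simp⟩
  | add s t hs ht =>
    obtain ⟨C, h⟩ := hs
    obtain ⟨D, h'⟩ := ht
    exact ⟨C + D, fun π σ => by
      rw [map_add]; exact (norm_add_le _ _).trans (add_le_add (h π σ) (h' π σ))⟩
  | tmul a b =>
    refine ⟨‖a‖ * ‖b‖, fun π σ => ?_⟩
    rw [tensorHom_tmul]
    exact (HilbertTensor.norm_map_le _ _).trans (mul_le_mul (NonUnitalStarAlgHom.norm_apply_le _ _)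
      (NonUnitalStarAlgHom.norm_apply_le _ _) (norm_nonneg _) (norm_nonneg _))

/-- The minimal C*-norm `‖t‖ = sup ‖(π ⊗ σ) t‖`, over all representations `π` of `A` and `σ`
of `B`. -/
def seminorm (A B : Type u) [CStarAlgebra A] [CStarAlgebra B] : CStarSeminorm (A ⊗[ℂ] B) :=
  .sup (fun r : Rep A × Rep B => .ofHom (tensorHom r.1.hom r.2.hom)) bddAbove

end MinTensor

/-- The minimal (spatial) tensor product of two C*-algebras. -/
def MinTensor (A B : Type u) [CStarAlgebra A] [CStarAlgebra B] : Type u :=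
  (MinTensor.seminorm A B).CStarCompletion

instance (A B : Type u) [CStarAlgebra A] [CStarAlgebra B] : CStarAlgebra (MinTensor A B) :=
  (inferInstance : CStarAlgebra (MinTensor.seminorm A B).CStarCompletion)

namespace MinTensor

variable {A B C D : Type u} [CStarAlgebra A] [CStarAlgebra B] [CStarAlgebra C] [CStarAlgebra D]

/-- The canonical map from the algebraic tensor product. -/
def ofAlg : A ⊗[ℂ] B →ₐ[ℂ] MinTensor A B := CStarSeminorm.CStarCompletion.of (seminorm A B)

theorem norm_ofAlg (t : A ⊗[ℂ] B) : ‖ofAlg t‖ = (seminorm A B).val t :=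
  CStarSeminorm.CStarCompletion.norm_of (seminorm A B) t

theorem star_ofAlg (t : A ⊗[ℂ] B) : star (ofAlg t) = ofAlg (star t) :=
  CStarSeminorm.CStarCompletion.star_of (seminorm A B) t

/-- The elementary tensor `a ⊗ b`. -/
def tmul (a : A) (b : B) : MinTensor A B := ofAlg (a ⊗ₜ[ℂ] b)

/-- `f ⊗ g` on the algebraic tensor product. -/
def algMap (f : A →⋆ₐ[ℂ] C) (g : B →⋆ₐ[ℂ] D) : A ⊗[ℂ] B →⋆ₐ[ℂ] MinTensor C D where
  __ := ofAlg.comp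
    (Algebra.TensorProduct.map (f : A →ₐ[ℂ] C) (g : B →ₐ[ℂ] D))
  map_star' t := by
    change ofAlg (Algebra.TensorProduct.map _ _ _) = star (ofAlg (Algebra.TensorProduct.map _ _ _))
    rw [star_ofAlg]
    congr 1
    induction t using TensorProduct.induction_on with
    | zero => simp
    | add s t hs ht => rw [star_add, map_add, hs, ht, map_add, star_add]
    | tmul a b => simp [map_star]

theorem norm_algMap_le (f : A →⋆ₐ[ℂ] C) (g : B →⋆ₐ[ℂ] D) (t : A ⊗[ℂ] B) :
    ‖algMap f g t‖ ≤ (seminorm A B).val t := by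
  refine (norm_ofAlg _).trans_le ?_
  refine Real.iSup_le (fun r => ?_) (CStarSeminorm.val_nonneg _ _)
  refine le_trans (le_of_eq ?_)
    (le_ciSup (bddAbove t) (⟨r.1.H, r.1.hom.comp f⟩, ⟨r.2.H, r.2.hom.comp g⟩))
  exact congrArg norm (tensorHom_comp r.1.hom r.2.hom f g t)

/-- The *-homomorphism `f ⊗ g` of minimal tensor products. -/
def map (f : A →⋆ₐ[ℂ] C) (g : B →⋆ₐ[ℂ] D) : MinTensor A B →⋆ₐ[ℂ] MinTensor C D :=
  CStarSeminorm.CStarCompletion.lift (seminorm A B) (algMap f g) (norm_algMap_le f g)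

theorem map_tmul (f : A →⋆ₐ[ℂ] C) (g : B →⋆ₐ[ℂ] D) (a : A) (b : B) :
    map f g (tmul a b) = tmul (f a) (g b) :=
  CStarSeminorm.CStarCompletion.lift_of (seminorm A B) (algMap f g) (norm_algMap_le f g) (a ⊗ₜ b)

variable (A B C) in
/-- The graph of the canonical identification `(A ⊗ B) ⊗ C ≅ A ⊗ (B ⊗ C)`: the closed linear span
of the pairs `((a ⊗ b) ⊗ c, a ⊗ (b ⊗ c))`. -/
def assocGraph : Submodule ℂ (MinTensor (MinTensor A B) C × MinTensor A (MinTensor B C)) :=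
  (Submodule.span ℂ {z | ∃ a b c, z = (tmul (tmul a b) c, tmul a (tmul b c))}).topologicalClosure

end MinTensor

/-! ## Compact quantum groups -/

/-- `(A, Δ)` is a compact quantum group: `Δ` is coassociative and has the cancellation property. -/
structure IsCompactQuantumGroup {A : Type u} [CStarAlgebra A] (Δ : A →⋆ₐ[ℂ] MinTensor A A) :
    Prop where
  /-- `(Δ ⊗ id) Δ = (id ⊗ Δ) Δ` under the identification `(A ⊗ A) ⊗ A ≅ A ⊗ (A ⊗ A)`. -/
  coassoc : ∀ a, (MinTensor.map Δ (StarAlgHom.id ℂ A) (Δ a),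
    MinTensor.map (StarAlgHom.id ℂ A) Δ (Δ a)) ∈ MinTensor.assocGraph A A A
  dense_one_tmul : Dense (Submodule.span ℂ
    {z | ∃ a b : A, z = MinTensor.tmul 1 a * Δ b} : Set (MinTensor A A))
  dense_tmul_one : Dense (Submodule.span ℂ
    {z | ∃ a b : A, z = MinTensor.tmul a 1 * Δ b} : Set (MinTensor A A))

/-- `Δ (u x a) = ∑ r, u x r ⊗ u r a`. -/
def IsMatrixComultiplication {W : Type*} [Fintype W] {A : Type u} [CStarAlgebra A]
    (u : W → W → A) (Δ : A →⋆ₐ[ℂ] MinTensor A A) : Prop :=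
  ∀ x a, Δ (u x a) = ∑ r, MinTensor.tmul (u x r) (u r a)

/-! ## Nonlocal games -/

/-- A nonlocal game with question sets `X`, `Y` and answer sets `A`, `B`, given by its predicate:
`V a b x y` is `V(a,b|x,y)`. -/
structure NonlocalGame (X Y A B : Type*) where
  V : A → B → X → Y → Bool

namespace NonlocalGame

/-- `V(a,b|x,x) = 0` for `a ≠ b`. -/
def IsSynchronous {I O : Type*} (G : NonlocalGame I I O O) : Prop :=
  ∀ x a b, a ≠ b → G.V a b x x = false

/-- Synchronous, and `V(a,a|x,y) = 0` for `x ≠ y`. -/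
def IsBisynchronous {I O : Type*} (G : NonlocalGame I I O O) : Prop :=
  G.IsSynchronous ∧ ∀ a x y, x ≠ y → G.V a a x y = false

/-- `V(a,b|r,s) = V(r,s|x,y) = 1` implies `V(a,b|x,y) = 1`. -/
def IsTransitive {W : Type*} (G : NonlocalGame W W W W) : Prop :=
  ∀ a b r s x y, G.V a b r s = true → G.V r s x y = true → G.V a b x y = true

end NonlocalGame

/-- A quantum strategy: finite-dimensional Hilbert spaces, a shared state `ψ`, and projection valued
measures `P x` for Alice and `Q y` for Bob. -/
structure QuantumStrategy (X Y A B : Type*) [Fintype A] [Fintype B] where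
  HA : Type
  HB : Type
  [normedA : NormedAddCommGroup HA]
  [innerA : InnerProductSpace ℂ HA]
  [completeA : CompleteSpace HA]
  [finiteA : FiniteDimensional ℂ HA]
  [normedB : NormedAddCommGroup HB]
  [innerB : InnerProductSpace ℂ HB]
  [completeB : CompleteSpace HB]
  [finiteB : FiniteDimensional ℂ HB]
  ψ : HA ⊗[ℂ] HB
  norm_ψ : ‖ψ‖ = 1
  P : X → A → HA →L[ℂ] HA
  P_proj : ∀ x a, IsStarProjection (P x a)
  P_sum : ∀ x, ∑ a, P x a = 1
  Q : Y → B → HB →L[ℂ] HB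
  Q_proj : ∀ y b, IsStarProjection (Q y b)
  Q_sum : ∀ y, ∑ b, Q y b = 1

namespace QuantumStrategy

variable {X Y A B : Type*} [Fintype A] [Fintype B]

attribute [instance] normedA innerA completeA finiteA normedB innerB completeB finiteB

/-- The correlation `p(a,b|x,y) = ⟨(P x a ⊗ Q y b) ψ, ψ⟩` (Mathlib's inner product is linear in the
second variable). -/
def correlation (S : QuantumStrategy X Y A B) (a : A) (b : B) (x : X) (y : Y) : ℂ :=
  inner ℂ S.ψ (TensorProduct.mapL (S.P x a) (S.Q y b) S.ψ)

/-- The strategy never loses: `V(a,b|x,y) = 0` implies `p(a,b|x,y) = 0`. -/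
def IsPerfect (S : QuantumStrategy X Y A B) (G : NonlocalGame X Y A B) : Prop :=
  ∀ a b x y, G.V a b x y = false → S.correlation a b x y = 0

end QuantumStrategy

/-- The game has a perfect quantum strategy. -/
def NonlocalGame.HasPerfectQuantumStrategy {X Y A B : Type*} [Fintype A] [Fintype B]
    (G : NonlocalGame X Y A B) : Prop :=
  ∃ S : QuantumStrategy X Y A B, S.IsPerfect G

/-! ## The C*-algebra of a synchronous game -/

/-- The defining relations of the algebra of a synchronous game. -/
structure NonlocalGame.Relations {I O : Type*} [Fintype O] (G : NonlocalGame I I O O)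
    {R : Type*} [Ring R] [StarRing R] (u : I → O → R) : Prop where
  proj : ∀ x a, IsStarProjection (u x a)
  sum_eq_one : ∀ x, ∑ a, u x a = 1
  mul_eq_zero : ∀ a b x y, G.V a b x y = false → u x a * u y b = 0

namespace NonlocalGame

variable {I O : Type u} [Fintype O] (G : NonlocalGame I I O O)

/-- The relations of the game, on generators indexed by `I × O`. -/
def cstarRelations : CStarRelations (I × O) where
  Holds _ _ _ _ T := G.Relations fun x a => T (x, a)
  bounded x := ⟨1, fun _ _ _ _ _ h => (h.proj x.1 x.2).norm_le⟩

/-- The universal C*-algebra `C*(G)` of the game. -/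
abbrev CStar : Type u := G.cstarRelations.Universal

/-- The canonical generators `u x a` of `C*(G)`. -/
def gen (x : I) (a : O) : G.CStar := G.cstarRelations.gen (x, a)

end NonlocalGame

/-! ## Quantum automorphism groups of labelled complete digraphs -/

/-- A simple complete directed graph on `W` (one edge `(x, y)` for each ordered pair of distinct
vertices) whose vertices and edges are labelled by elements of `L`. -/
structure LabelledCompleteDigraph (W L : Type*) where
  vertexLabel : W → L
  edgeLabel : {e : W × W // e.1 ≠ e.2} → L

namespace LabelledCompleteDigraph

section

variable {W L : Type*} (Γ : LabelledCompleteDigraph W L) (R : Type*) [Zero R] [One R]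

open Classical in
/-- The adjacency matrix of the edges with label `c`. -/
def edgeMatrix (c : L) : Matrix W W R :=
  Matrix.of fun x y => if ∃ h : x ≠ y, Γ.edgeLabel ⟨(x, y), h⟩ = c then 1 else 0

open Classical in
/-- The diagonal matrix which indicates the vertices with label `c`. -/
def vertexMatrix (c : L) : Matrix W W R :=
  Matrix.diagonal fun x => if Γ.vertexLabel x = c then 1 else 0

end

open scoped Matrix

/-- The defining relations of the quantum automorphism group: `U` is a magic unitary which commutes
with the adjacency matrix of every edge label and the diagonal matrix of every vertex label. -/
structure Relations {W L : Type*} [Fintype W] [DecidableEq W] (Γ : LabelledCompleteDigraph W L)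
    {R : Type*} [Ring R] [StarRing R] (U : Matrix W W R) : Prop where
  proj : ∀ x a, IsStarProjection (U x a)
  conjTranspose_mul : Uᴴ * U = 1
  mul_conjTranspose : U * Uᴴ = 1
  edge_comm : ∀ c, Γ.edgeMatrix R c * U = U * Γ.edgeMatrix R c
  vertex_comm : ∀ c, Γ.vertexMatrix R c * U = U * Γ.vertexMatrix R c

variable {W : Type u} {L : Type*} [Fintype W] [DecidableEq W] (Γ : LabelledCompleteDigraph W L)

/-- The relations of the quantum automorphism group, on generators indexed by `W × W`. -/
def cstarRelations : CStarRelations (W × W) where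
  Holds _ _ _ _ T := Γ.Relations (Matrix.of fun x a => T (x, a))
  bounded x := ⟨1, fun _ _ _ _ _ h => (h.proj x.1 x.2).norm_le⟩

/-- The universal C*-algebra `C(Qut(Γ))`. -/
abbrev Qut : Type u := Γ.cstarRelations.Universal

/-- The canonical generators of `C(Qut(Γ))`. -/
def qutGen (x a : W) : Γ.Qut := Γ.cstarRelations.gen (x, a)

end LabelledCompleteDigraph

/-! ## Orbitals -/

section Orbitals

variable {W R : Type*} [Mul R] [Zero R]

/-- The orbital relation on `W × W` of a matrix `u`: `(x, y) ∼ (a, b)` iff `u x a * u y b ≠ 0`. -/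
def OrbitalRel (u : W → W → R) (p q : W × W) : Prop := u p.1 q.1 * u p.2 q.2 ≠ 0

/-- The orbital of `p`. -/
def orbital (u : W → W → R) (p : W × W) : Set (W × W) := {q | OrbitalRel u p q}

/-- The complete digraph on `W` in which each edge `(x, y)` is labelled by the orbital of `(x, y)`
and each vertex `x` is labelled by the orbital of the pair `(x, x)`. -/
def orbitalGraph (u : W → W → R) : LabelledCompleteDigraph W (Set (W × W)) where
  vertexLabel x := orbital u (x, x)
  edgeLabel e := orbital u e.1

end Orbitals

end

noncomputable section

open scoped TensorProduct Matrix

/-! ## Orthogonality in C*-algebras -/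

section CStar

variable {A : Type*} [CStarAlgebra A]

/-! The matrix `u` of generators of `C*(G)` is a magic unitary: bisynchronicity makes the elements
`1 - ∑ x, u x a` projections, and their sum over `a` is `|W| - |W| = 0`, so each of them vanishes.
Transitivity of the game says exactly that `∑ r, u x r ⊗ u r a` again satisfies the game relations.
The universal property therefore gives `Δ`, and a magic unitary with such a `Δ` whose entries
generate the algebra yields a compact quantum group.

The orbital relation is transitive because `Δ (u x a * u y b)` can be multiplied on both sides to
give any tensor `(u x r * u y s) ⊗ (u r a * u s b)`, which is nonzero when both legs are. It is
symmetric by a finite counting argument: the positive elements `(u x a * u y b)* (u x a * u y b)`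
form a doubly stochastic matrix indexed by `W × W`, and for such a matrix nothing can enter a set of
indices that nothing leaves. For reflexivity the algebra must be nonzero, and this is the only use
of the perfect strategy: the projections of Alice, compressed to the vectors `(1 ⊗ Y) ψ`, represent
the game relations.

Once orbitals are equivalence classes, `u x a * u y b` vanishes whenever `(x, y)` and `(a, b)` lie
in different orbitals, which is what commuting with the label matrices of the orbital graph
requires. Conversely, commuting with those matrices forces `v x a * v y b = 0` across different
labels, hence all game relations. The two universal properties give mutually inverse homomorphisms,
and `Δ'` is `Δ` transported along the isomorphism. -/

theorem eq_zero_of_sum_star_mul_self_eq_zero {ι : Type*} {s : Finset ι} {f : ι → A}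
    (h : ∑ i ∈ s, star (f i) * f i = 0) {i : ι} (hi : i ∈ s) : f i = 0 := by
  -- In the spectral order each summand is nonnegative, so a vanishing sum has vanishing terms.
  let _ := CStarAlgebra.spectralOrder A
  have := CStarAlgebra.spectralOrderedRing A
  have h1 := (Finset.sum_eq_zero_iff_of_nonneg fun j _ => star_mul_self_nonneg (f j)).mp h i hi
  exact CStarRing.star_mul_self_eq_zero_iff _ |>.mp h1

theorem IsStarProjection.star_mul_mul_self {p : A} (hp : IsStarProjection p) (a : A) :
    star (p * a) * (p * a) = star a * p * a := by
  rw [star_mul, hp.isSelfAdjoint.star_eq, mul_assoc, ← mul_assoc p p a, hp.isIdempotentElem.eq,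
    mul_assoc]

/-- Compressing `∑ k, p k = 1` by `p j` gives `∑ k, (p k * p j)* (p k * p j) = p j`. The term `k =
j` already equals `p j`, so the others sum to zero. -/
theorem mul_eq_zero_of_isStarProjection_of_sum_eq_one {ι : Type*} [Fintype ι] {p : ι → A}
    (hp : ∀ i, IsStarProjection (p i)) (hs : ∑ i, p i = 1) {i j : ι} (hij : i ≠ j) :
    p i * p j = 0 := by
  classical
  have h1 : ∑ k ∈ Finset.univ.erase j, star (p k * p j) * (p k * p j) = 0 := by
    have h2 : ∑ k, star (p k * p j) * (p k * p j) = p j := by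
      simp_rw [(hp _).star_mul_mul_self, (hp j).isSelfAdjoint.star_eq]
      rw [← Finset.sum_mul, ← Finset.mul_sum, hs, mul_one, (hp j).isIdempotentElem.eq]
    rw [← Finset.add_sum_erase _ _ (Finset.mem_univ j), (hp j).isIdempotentElem.eq,
      (hp j).isSelfAdjoint.star_eq, (hp j).isIdempotentElem.eq] at h2
    simpa using h2
  exact eq_zero_of_sum_star_mul_self_eq_zero h1 (Finset.mem_erase.mpr ⟨hij, Finset.mem_univ i⟩)

theorem StarAlgHom.continuous_of_cstar {B : Type*} [CStarAlgebra B] (f : A →⋆ₐ[ℂ] B) :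
    Continuous f :=
  AddMonoidHomClass.continuous_of_bound f 1 fun a => by
    rw [one_mul]; exact NonUnitalStarAlgHom.norm_apply_le f a

end CStar

/-! ## Norming families of representations -/

/-- The norm of `B` is determined by the representations of `B` on Hilbert spaces in `Type u`. -/
def IsNormedByReps (B : Type*) [CStarAlgebra B] : Prop :=
  ∀ (b : B) (C : ℝ), 0 ≤ C → (∀ (H : Type u) [NormedAddCommGroup H] [InnerProductSpace ℂ H]
    [CompleteSpace H] (ρ : B →⋆ₐ[ℂ] (H →L[ℂ] H)), ‖ρ b‖ ≤ C) → ‖b‖ ≤ C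

theorem IsNormedByReps.exists_ne_zero {B : Type*} [CStarAlgebra B] (hB : IsNormedByReps.{u} B)
    {b : B} (hb : b ≠ 0) : ∃ (H : Type u) (_ : NormedAddCommGroup H) (_ : InnerProductSpace ℂ H)
    (_ : CompleteSpace H) (ρ : B →⋆ₐ[ℂ] (H →L[ℂ] H)), ρ b ≠ 0 := by
  by_contra! h
  exact hb (norm_le_zero_iff.mp (hB b 0 le_rfl fun H _ _ _ ρ => by rw [h H _ _ _ ρ, norm_zero]))

/-- Representations are contractive, so the bound only has to be tested on the dense image of `F`.
The algebras at hand are completions for suprema over representations, hence satisfy it by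
construction, without the Gelfand–Naimark theorem. -/
theorem CStarSeminorm.CStarCompletion.isNormedByReps {F : Type*} [Ring F] [StarRing F]
    [Algebra ℂ F] [StarModule ℂ F] (p : CStarSeminorm F)
    (h : ∀ (a : F) (C : ℝ), 0 ≤ C → (∀ (H : Type u) [NormedAddCommGroup H] [InnerProductSpace ℂ H]
      [CompleteSpace H] (ρ : p.CStarCompletion →⋆ₐ[ℂ] (H →L[ℂ] H)), ‖ρ (of p a)‖ ≤ C) →
      p.val a ≤ C) : IsNormedByReps.{u} p.CStarCompletion := by
  intro b C hC hb
  refine le_of_forall_pos_le_add fun ε hε => ?_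
  obtain ⟨a, ha⟩ := (denseRange_of p).exists_dist_lt b (half_pos hε)
  rw [dist_eq_norm] at ha
  have h1 : ‖of p a‖ ≤ C + ε / 2 := by
    rw [norm_of]
    refine h a _ (by positivity) fun H _ _ _ ρ => ?_
    have h2 : ρ (of p a) = ρ b - ρ (b - of p a) := by rw [map_sub]; abel
    rw [h2]
    refine (norm_sub_le _ _).trans (add_le_add (hb H ρ) ?_)
    exact (NonUnitalStarAlgHom.norm_apply_le ρ _).trans ha.le
  have h3 : ‖b‖ ≤ ‖b - of p a‖ + ‖of p a‖ := by
    simpa using norm_add_le (b - of p a) (of p a)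
  linarith

/-! ### The universal property of a C*-algebra given by generators and relations -/

namespace CStarRelations

open CStarSeminorm

variable {X : Type u} (R : CStarRelations X)

theorem norm_lift_le (r : R.Rep) (a : FreeStarAlgebra X) :
    ‖FreeStarAlgebra.lift r.T a‖ ≤ R.seminorm.val a :=
  le_ciSup (R.bddAbove a) r

theorem seminorm_le {a : FreeStarAlgebra X} {C : ℝ} (hC : 0 ≤ C)
    (h : ∀ r : R.Rep, ‖FreeStarAlgebra.lift r.T a‖ ≤ C) : R.seminorm.val a ≤ C :=
  Real.iSup_le h hC

/-- The canonical map of the free *-algebra onto a dense *-subalgebra of the universal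
C*-algebra. -/
def ofFree : FreeStarAlgebra X →⋆ₐ[ℂ] R.Universal where
  __ := CStarCompletion.of R.seminorm
  map_star' a := (CStarCompletion.star_of R.seminorm a).symm

theorem norm_ofFree (a : FreeStarAlgebra X) : ‖R.ofFree a‖ = R.seminorm.val a :=
  CStarCompletion.norm_of R.seminorm a

theorem ofFree_eq_zero {a : FreeStarAlgebra X}
    (h : ∀ r : R.Rep, FreeStarAlgebra.lift r.T a = 0) : R.ofFree a = 0 := by
  rw [← norm_le_zero_iff, norm_ofFree]
  exact R.seminorm_le le_rfl fun r => by rw [h r, norm_zero]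

theorem ofFree_eq {a b : FreeStarAlgebra X}
    (h : ∀ r : R.Rep, FreeStarAlgebra.lift r.T a = FreeStarAlgebra.lift r.T b) :
    R.ofFree a = R.ofFree b := by
  rw [← sub_eq_zero, ← map_sub]
  exact R.ofFree_eq_zero fun r => by rw [map_sub, h r, sub_self]

theorem isClosed_induction {P : R.Universal → Prop} (hc : IsClosed {x | P x})
    (h1 : ∀ c : ℂ, P (algebraMap ℂ _ c)) (hg : ∀ x, P (R.gen x)) (hg' : ∀ x, P (star (R.gen x)))
    (hm : ∀ a b, P a → P b → P (a * b)) (ha : ∀ a b, P a → P b → P (a + b)) (x : R.Universal) :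
    P x := by
  refine CStarCompletion.induction_of R.seminorm hc (fun a => ?_) x
  change P (R.ofFree a)
  induction a using FreeStarAlgebra.induction with
  | h1 c => rw [AlgHomClass.commutes]; exact h1 c
  | hl y =>
    cases y with
    | inl x => exact hg x
    | inr x =>
      have e : (FreeStarAlgebra.letter (.inr x) : FreeStarAlgebra X) =
          star (FreeStarAlgebra.gen x) :=
        (FreeStarAlgebra.star_letter (.inl x)).symm
      rw [e, map_star]
      exact hg' x
  | ha a b iha ihb => rw [map_add]; exact ha _ _ iha ihb
  | hm a b iha ihb => rw [map_mul]; exact hm _ _ iha ihb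

/-- The representation of the universal C*-algebra given by a representation of the relations. -/
def Rep.toHom {R : CStarRelations X} (r : R.Rep) : R.Universal →⋆ₐ[ℂ] (r.H →L[ℂ] r.H) :=
  CStarCompletion.lift R.seminorm (FreeStarAlgebra.lift r.T) (R.norm_lift_le r)

theorem Rep.toHom_ofFree {R : CStarRelations X} (r : R.Rep) (a : FreeStarAlgebra X) :
    r.toHom (R.ofFree a) = FreeStarAlgebra.lift r.T a :=
  CStarCompletion.lift_of R.seminorm (FreeStarAlgebra.lift r.T) (R.norm_lift_le r) a

theorem isNormedByReps : IsNormedByReps.{u} R.Universal := by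
  refine CStarCompletion.isNormedByReps R.seminorm fun a C hC h => ?_
  refine R.seminorm_le hC fun r => ?_
  rw [← r.toHom_ofFree]
  exact h r.H r.toHom

theorem _root_.FreeStarAlgebra.hom_ext {B : Type*} [Ring B] [StarRing B] [Algebra ℂ B]
    {f g : FreeStarAlgebra X →⋆ₐ[ℂ] B}
    (h : ∀ x, f (FreeStarAlgebra.gen x) = g (FreeStarAlgebra.gen x)) : f = g := by
  ext a
  induction a using FreeStarAlgebra.induction with
  | h1 c => rw [AlgHomClass.commutes, AlgHomClass.commutes]
  | hl y =>
    cases y with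
    | inl x => exact h x
    | inr x =>
      have e : (FreeStarAlgebra.letter (.inr x) : FreeStarAlgebra X) =
          star (FreeStarAlgebra.gen x) :=
        (FreeStarAlgebra.star_letter (.inl x)).symm
      rw [e, map_star, map_star, h x]
  | ha a b iha ihb => rw [map_add, map_add, iha, ihb]
  | hm a b iha ihb => rw [map_mul, map_mul, iha, ihb]

variable {B : Type*} [CStarAlgebra B]

/-- Composing with a representation of `B` gives a representation of the relations, one of those
over which the universal seminorm is the supremum; such representations determine the norm of `B`.
-/
theorem norm_lift_le_seminorm (hB : IsNormedByReps.{u} B) {f : X → B}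
    (hf : ∀ (H : Type u) [NormedAddCommGroup H] [InnerProductSpace ℂ H] [CompleteSpace H]
      (ρ : B →⋆ₐ[ℂ] (H →L[ℂ] H)), R.Holds H fun x => ρ (f x)) (a : FreeStarAlgebra X) :
    ‖FreeStarAlgebra.lift f a‖ ≤ R.seminorm.val a := by
  refine hB _ _ (R.seminorm.val_nonneg a) fun H _ _ _ ρ => ?_
  have h1 : ρ.comp (FreeStarAlgebra.lift f) = FreeStarAlgebra.lift fun x => ρ (f x) :=
    FreeStarAlgebra.hom_ext fun x => by
      rw [StarAlgHom.comp_apply, FreeStarAlgebra.lift_gen, FreeStarAlgebra.lift_gen]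
  rw [← StarAlgHom.comp_apply, h1]
  exact R.norm_lift_le ⟨H, fun x => ρ (f x), hf H ρ⟩ a

/-- The universal property: a family of elements of a C*-algebra `B` which satisfies the relations
in every representation of `B` determines a *-homomorphism. -/
def lift (hB : IsNormedByReps.{u} B) (f : X → B)
    (hf : ∀ (H : Type u) [NormedAddCommGroup H] [InnerProductSpace ℂ H] [CompleteSpace H]
      (ρ : B →⋆ₐ[ℂ] (H →L[ℂ] H)), R.Holds H fun x => ρ (f x)) : R.Universal →⋆ₐ[ℂ] B :=
  CStarCompletion.lift R.seminorm (FreeStarAlgebra.lift f) (R.norm_lift_le_seminorm hB hf)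

theorem lift_gen (hB : IsNormedByReps.{u} B) (f : X → B)
    (hf : ∀ (H : Type u) [NormedAddCommGroup H] [InnerProductSpace ℂ H] [CompleteSpace H]
      (ρ : B →⋆ₐ[ℂ] (H →L[ℂ] H)), R.Holds H fun x => ρ (f x)) (x : X) :
    R.lift hB f hf (R.gen x) = f x :=
  (CStarCompletion.lift_of R.seminorm _ (R.norm_lift_le_seminorm hB hf) _).trans
    (FreeStarAlgebra.lift_gen f x)

theorem hom_ext {f g : R.Universal →⋆ₐ[ℂ] B} (h : ∀ x, f (R.gen x) = g (R.gen x)) : f = g := by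
  have hf : Continuous f := f.continuous_of_cstar
  have hg : Continuous g := g.continuous_of_cstar
  ext z
  refine R.isClosed_induction (P := fun z => f z = g z) (isClosed_eq hf hg) (fun c => ?_) h
    (fun x => ?_) (fun a b ha hb => ?_) (fun a b ha hb => ?_) z
  · rw [AlgHomClass.commutes, AlgHomClass.commutes]
  · rw [map_star, map_star, h]
  · rw [map_mul, map_mul, ha, hb]
  · rw [map_add, map_add, ha, hb]

end CStarRelations

/-! ## Minimal tensor products -/

theorem HilbertTensor.map_ne_zero {H K : Type u} [NormedAddCommGroup H] [InnerProductSpace ℂ H]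
    [NormedAddCommGroup K] [InnerProductSpace ℂ K] {S : H →L[ℂ] H} {T : K →L[ℂ] K} (hS : S ≠ 0)
    (hT : T ≠ 0) : map S T ≠ 0 := by
  obtain ⟨x, hx⟩ : ∃ x, S x ≠ 0 := by
    by_contra! h
    exact hS (ContinuousLinearMap.ext h)
  obtain ⟨y, hy⟩ : ∃ y, T y ≠ 0 := by
    by_contra! h
    exact hT (ContinuousLinearMap.ext h)
  intro h
  have h1 : inner ℂ (map S T (of (x ⊗ₜ y))) (map S T (of (x ⊗ₜ y))) = 0 := by simp [h]
  rw [map_tmul, inner_of, TensorProduct.inner_tmul, mul_eq_zero, inner_self_eq_zero,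
    inner_self_eq_zero] at h1
  exact h1.elim hx hy

namespace MinTensor

open CStarSeminorm

variable {A B : Type u} [CStarAlgebra A] [CStarAlgebra B]

theorem norm_tensorHom_le (π : Rep A) (σ : Rep B) (t : A ⊗[ℂ] B) :
    ‖tensorHom π.hom σ.hom t‖ ≤ (seminorm A B).val t :=
  le_ciSup (bddAbove t) (π, σ)

/-- The representation `π ⊗ σ` of the minimal tensor product. -/
def Rep.prod (π : Rep A) (σ : Rep B) :
    MinTensor A B →⋆ₐ[ℂ] (HilbertTensor π.H σ.H →L[ℂ] HilbertTensor π.H σ.H) :=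
  CStarCompletion.lift (seminorm A B) (tensorHom π.hom σ.hom) (norm_tensorHom_le π σ)

theorem Rep.prod_ofAlg (π : Rep A) (σ : Rep B) (t : A ⊗[ℂ] B) :
    π.prod σ (ofAlg t) = tensorHom π.hom σ.hom t :=
  CStarCompletion.lift_of (seminorm A B) _ (norm_tensorHom_le π σ) t

theorem isNormedByReps (A B : Type u) [CStarAlgebra A] [CStarAlgebra B] :
    IsNormedByReps.{u} (MinTensor A B) := by
  refine CStarCompletion.isNormedByReps (seminorm A B) fun t C hC h => ?_
  refine Real.iSup_le (fun r => ?_) hC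
  refine le_trans (le_of_eq ?_) (h (HilbertTensor r.1.H r.2.H) (r.1.prod r.2))
  exact congrArg norm (r.1.prod_ofAlg r.2 t).symm

/-- Representations `π` and `σ` with `π a ≠ 0` and `σ b ≠ 0` combine to `π ⊗ σ`, which does not kill
`a ⊗ b`. Transitivity of the orbital relation rests on this. -/
theorem tmul_ne_zero (hA : IsNormedByReps.{u} A) (hB : IsNormedByReps.{u} B) {a : A} {b : B}
    (ha : a ≠ 0) (hb : b ≠ 0) : tmul a b ≠ 0 := by
  obtain ⟨H, _, _, _, π, hπ⟩ := hA.exists_ne_zero ha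
  obtain ⟨K, _, _, _, σ, hσ⟩ := hB.exists_ne_zero hb
  intro h
  have h1 := (Rep.mk H π).prod_ofAlg (Rep.mk K σ) (a ⊗ₜ b)
  rw [tensorHom_tmul] at h1
  refine HilbertTensor.map_ne_zero hπ hσ (h1.symm.trans ?_)
  exact (congrArg _ h).trans (map_zero _)

theorem tmul_mul_tmul (a a' : A) (b b' : B) :
    tmul a b * tmul a' b' = tmul (a * a') (b * b') := by
  rw [tmul, tmul, ← map_mul, Algebra.TensorProduct.tmul_mul_tmul]; rfl

theorem star_tmul (a : A) (b : B) : star (tmul a b) = tmul (star a) (star b) := by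
  rw [tmul, star_ofAlg, TensorProduct.star_tmul]; rfl

theorem tmul_one_one : tmul (1 : A) (1 : B) = 1 := map_one ofAlg

/-- `a ↦ a ⊗ b` as a linear map. -/
def tmulLeft (b : B) : A →ₗ[ℂ] MinTensor A B :=
  ofAlg.toLinearMap ∘ₗ (TensorProduct.mk ℂ A B).flip b

/-- `b ↦ a ⊗ b` as a linear map. -/
def tmulRight (a : A) : B →ₗ[ℂ] MinTensor A B :=
  ofAlg.toLinearMap ∘ₗ TensorProduct.mk ℂ A B a

theorem sum_tmul {ι : Type*} (s : Finset ι) (f : ι → A) (b : B) :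
    tmul (∑ i ∈ s, f i) b = ∑ i ∈ s, tmul (f i) b := map_sum (tmulLeft b) f s

theorem tmul_sum {ι : Type*} (s : Finset ι) (a : A) (f : ι → B) :
    tmul a (∑ i ∈ s, f i) = ∑ i ∈ s, tmul a (f i) := map_sum (tmulRight a) f s

protected theorem sum_mul {ι : Type*} (s : Finset ι) (f : ι → MinTensor A B) (z : MinTensor A B) :
    (∑ i ∈ s, f i) * z = ∑ i ∈ s, f i * z := Finset.sum_mul s f z

protected theorem mul_sum {ι : Type*} (s : Finset ι) (f : ι → MinTensor A B) (z : MinTensor A B) :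
    z * ∑ i ∈ s, f i = ∑ i ∈ s, z * f i := Finset.mul_sum s f z

theorem zero_tmul (b : B) : tmul (0 : A) b = 0 := map_zero (tmulLeft b)

theorem tmul_zero (a : A) : tmul a (0 : B) = 0 := map_zero (tmulRight a)

theorem norm_tmul_le (a : A) (b : B) : ‖tmul a b‖ ≤ ‖a‖ * ‖b‖ := by
  refine (norm_ofAlg _).trans_le (Real.iSup_le (fun r => ?_) (by positivity))
  exact (HilbertTensor.norm_map_le _ _).trans (mul_le_mul (NonUnitalStarAlgHom.norm_apply_le _ _)
      (NonUnitalStarAlgHom.norm_apply_le _ _) (norm_nonneg _) (norm_nonneg _))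

theorem continuous_tmulLeft (b : B) : Continuous (tmulLeft b : A → MinTensor A B) :=
  AddMonoidHomClass.continuous_of_bound (tmulLeft b) ‖b‖ fun a =>
    (norm_tmul_le a b).trans_eq (mul_comm _ _)

theorem continuous_tmulRight (a : A) : Continuous (tmulRight a : B → MinTensor A B) :=
  AddMonoidHomClass.continuous_of_bound (tmulRight a) ‖a‖ fun b => norm_tmul_le a b

theorem dense_of_tmul_mem {E : Submodule ℂ (MinTensor A B)}
    (h : ∀ a b, tmul a b ∈ closure (E : Set (MinTensor A B))) :
    Dense (E : Set (MinTensor A B)) := by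
  intro z
  refine CStarCompletion.induction_of (seminorm A B)
    (P := fun z => z ∈ closure (E : Set (MinTensor A B)))
    (isClosed_closure (s := (E : Set (MinTensor A B)))) (fun t => ?_) z
  change ofAlg t ∈ E.topologicalClosure
  induction t using TensorProduct.induction_on with
  | zero => rw [map_zero]; exact zero_mem _
  | add s t hs ht => rw [map_add]; exact add_mem hs ht
  | tmul a b => exact h a b

end MinTensor
/-! ## Magic unitaries -/

/-- A magic unitary: a matrix of projections whose rows and columns consist of mutually orthogonal
projections with sum `1`. -/
structure IsMagicUnitary {W A : Type*} [Fintype W] [Ring A] [StarRing A] (u : W → W → A) :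
    Prop where
  proj : ∀ x a, IsStarProjection (u x a)
  row_sum : ∀ x, ∑ a, u x a = 1
  col_sum : ∀ a, ∑ x, u x a = 1
  row_orth : ∀ x a b, a ≠ b → u x a * u x b = 0
  col_orth : ∀ x y a, x ≠ y → u x a * u y a = 0

section CStar

variable {W A : Type*} [Fintype W] [CStarAlgebra A] {u : W → W → A}

theorem isMagicUnitary_of_sums (hp : ∀ x a, IsStarProjection (u x a)) (hr : ∀ x, ∑ a, u x a = 1)
    (hc : ∀ a, ∑ x, u x a = 1) : IsMagicUnitary u where
  proj := hp
  row_sum := hr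
  col_sum := hc
  row_orth x _ _ := mul_eq_zero_of_isStarProjection_of_sum_eq_one (hp x) (hr x)
  col_orth _ _ a := mul_eq_zero_of_isStarProjection_of_sum_eq_one (fun x => hp x a) (hc a)

/-- The relations only give row sums. The column sums follow by counting: the defects `1 - ∑ x, u x
a` are projections which add up to zero because the matrix is square. -/
theorem NonlocalGame.Relations.isMagicUnitary {G : NonlocalGame W W W W}
    (hG : G.IsBisynchronous) (hu : G.Relations u) : IsMagicUnitary u := by
  classical
  refine isMagicUnitary_of_sums hu.proj hu.sum_eq_one fun a => ?_
  -- The second half of bisynchronicity makes the entries of a column orthogonal, so their sum is a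
  -- projection.
  have hcol : ∀ b, IsStarProjection (1 - ∑ x, u x b) := fun b => by
    refine IsStarProjection.one_sub ⟨?_, ?_⟩
    · rw [IsIdempotentElem, Finset.sum_mul_sum]
      refine Finset.sum_congr rfl fun x _ => ?_
      rw [Finset.sum_eq_single x (fun y _ hy => hu.mul_eq_zero _ _ _ _ (hG.2 b x y hy.symm))
        (by simp), (hu.proj x b).isIdempotentElem.eq]
    · rw [IsSelfAdjoint, star_sum]
      exact Finset.sum_congr rfl fun x _ => (hu.proj x b).isSelfAdjoint.star_eq
  have h : ∑ b, star (1 - ∑ x, u x b) * (1 - ∑ x, u x b) = 0 := by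
    simp_rw [(hcol _).isSelfAdjoint.star_eq, (hcol _).isIdempotentElem.eq]
    rw [Finset.sum_sub_distrib, Finset.sum_comm]
    simp [hu.sum_eq_one]
  exact (sub_eq_zero.mp (eq_zero_of_sum_star_mul_self_eq_zero h (Finset.mem_univ a))).symm

theorem LabelledCompleteDigraph.Relations.isMagicUnitary [DecidableEq W] {L : Type*}
    {Γ : LabelledCompleteDigraph W L} (hu : Γ.Relations (Matrix.of u)) : IsMagicUnitary u := by
  refine isMagicUnitary_of_sums hu.proj (fun x => ?_) (fun a => ?_)
  · have h := congrFun (congrFun hu.mul_conjTranspose x) x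
    rw [Matrix.mul_apply, Matrix.one_apply_eq] at h
    rw [← h]
    refine Finset.sum_congr rfl fun a _ => ?_
    have hp := hu.proj x a
    rw [Matrix.conjTranspose_apply, hp.isSelfAdjoint.star_eq, hp.isIdempotentElem.eq]
    rfl
  · have h := congrFun (congrFun hu.conjTranspose_mul a) a
    rw [Matrix.mul_apply, Matrix.one_apply_eq] at h
    rw [← h]
    refine Finset.sum_congr rfl fun x _ => ?_
    have hp := hu.proj x a
    rw [Matrix.conjTranspose_apply, hp.isSelfAdjoint.star_eq, hp.isIdempotentElem.eq]
    rfl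

open Classical in
theorem LabelledCompleteDigraph.vertexMatrix_mul_apply {R L : Type*} [Ring R]
    (Γ : LabelledCompleteDigraph W L) (c : L) (U : Matrix W W R) (x a : W) :
    (Γ.vertexMatrix R c * U) x a = if Γ.vertexLabel x = c then U x a else 0 := by
  rw [vertexMatrix, Matrix.diagonal_mul, ite_mul, one_mul, zero_mul]

open Classical in
theorem LabelledCompleteDigraph.mul_vertexMatrix_apply {R L : Type*} [Ring R]
    (Γ : LabelledCompleteDigraph W L) (c : L) (U : Matrix W W R) (x a : W) :
    (U * Γ.vertexMatrix R c) x a = if Γ.vertexLabel a = c then U x a else 0 := by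
  rw [vertexMatrix, Matrix.mul_diagonal, mul_ite, mul_one, mul_zero]

/-! ### Orbitals of a magic unitary and commutation with label matrices -/

namespace IsMagicUnitary

/-- The elements `(T p q)* (T p q)` are positive with all row and column sums equal to `1`. The set
`D` of points reachable from `q` is never left, so its rows sum to `|D|` inside `D`; its columns
also sum to `|D|`, so no mass enters from outside. If `p` were outside `D`, the nonzero `T p q`
would contradict this. -/
theorem orbitalRel_symm (hu : IsMagicUnitary u)
    (htrans : ∀ p q r, OrbitalRel u p q → OrbitalRel u q r → OrbitalRel u p r) {p q : W × W}
    (hpq : OrbitalRel u p q) : OrbitalRel u q p := by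
  classical
  by_cases hne : p = q
  · rwa [hne] at hpq ⊢
  by_contra hqp
  let T : W × W → W × W → A := fun p q => u p.1 q.1 * u p.2 q.2
  -- The point `q` is put in by hand, since reflexivity is not yet available.
  let D : Finset (W × W) := {r | r = q ∨ OrbitalRel u q r}
  have hT : ∀ p q, star (T p q) * T p q = u p.2 q.2 * u p.1 q.1 * u p.2 q.2 := fun p q => by
    rw [(hu.proj p.1 q.1).star_mul_mul_self, (hu.proj p.2 q.2).isSelfAdjoint.star_eq]
  have hrow : ∀ p, ∑ q, star (T p q) * T p q = 1 := fun p => by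
    simp_rw [hT]
    rw [Fintype.sum_prod_type, Finset.sum_comm]
    simp_rw [← Finset.sum_mul, ← Finset.mul_sum, hu.row_sum, mul_one,
      (hu.proj _ _).isIdempotentElem.eq, hu.row_sum]
  have hcol : ∀ q, ∑ p, star (T p q) * T p q = 1 := fun q => by
    simp_rw [hT]
    rw [Fintype.sum_prod_type, Finset.sum_comm]
    simp_rw [← Finset.sum_mul, ← Finset.mul_sum, hu.col_sum, mul_one,
      (hu.proj _ _).isIdempotentElem.eq, hu.col_sum]
  have hD : ∀ r ∈ D, ∀ s ∉ D, T r s = 0 := fun r hr s hs => by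
    by_contra h
    simp only [D, Finset.mem_filter_univ, not_or] at hr hs
    refine hs.2 ?_
    rcases hr with rfl | hr
    · exact h
    · exact htrans _ _ _ hr h
  have h1 : ∑ r ∈ D, ∑ s ∈ D, star (T r s) * T r s = D.card • (1 : A) := by
    rw [← Finset.sum_const]
    refine Finset.sum_congr rfl fun r hr => ?_
    rw [← hrow r]
    refine Finset.sum_subset (Finset.subset_univ _) fun s _ hs => ?_
    rw [hD r hr s hs, mul_zero]
  have h2 : ∑ s ∈ D, (∑ r ∈ D, star (T r s) * T r s + ∑ r ∈ Dᶜ, star (T r s) * T r s) =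
      D.card • (1 : A) := by
    rw [← Finset.sum_const]
    exact Finset.sum_congr rfl fun s _ => (Finset.sum_add_sum_compl _ _).trans (hcol s)
  -- Cancelling the block `D × D` leaves a vanishing sum over the entries from `Dᶜ` to `D`, one of
  -- which is `T p q`.
  rw [Finset.sum_add_distrib, Finset.sum_comm, h1, add_eq_left, ← Finset.sum_product'] at h2
  refine hpq (eq_zero_of_sum_star_mul_self_eq_zero (f := fun z => T z.2 z.1) h2
    (i := (q, p)) ?_)
  simp [D, hne, hqp]

theorem orbitalRel_equivalence [Nontrivial A] (hu : IsMagicUnitary u)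
    (htrans : ∀ p q r, OrbitalRel u p q → OrbitalRel u q r → OrbitalRel u p r) :
    Equivalence (OrbitalRel u) where
  refl p := by
    -- In a nonzero algebra the expansion of `1 = 1 * 1` along two rows has a nonzero term; symmetry
    -- and transitivity then lead back to `p`.
    obtain ⟨q, hq⟩ : ∃ q, OrbitalRel u p q := by
      by_contra! h
      have h1 : (∑ a, u p.1 a) * ∑ b, u p.2 b = 0 := by
        rw [Finset.sum_mul_sum]
        exact Finset.sum_eq_zero fun a _ => Finset.sum_eq_zero fun b _ =>
          not_not.mp (h (a, b))
      rw [hu.row_sum, hu.row_sum, mul_one] at h1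
      exact one_ne_zero h1
    exact htrans _ _ _ hq (hu.orbitalRel_symm htrans hq)
  symm := hu.orbitalRel_symm htrans
  trans := htrans _ _ _

/-- A magic unitary satisfies the relations of the quantum automorphism group of a digraph whose
labels are constant on its orbitals. -/
theorem relations_of_label_eq [DecidableEq W] {L : Type*} {Γ : LabelledCompleteDigraph W L}
    (hu : IsMagicUnitary u)
    (he : ∀ x y a b (hxy : x ≠ y) (hab : a ≠ b), u x a * u y b ≠ 0 →
      Γ.edgeLabel ⟨(x, y), hxy⟩ = Γ.edgeLabel ⟨(a, b), hab⟩)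
    (hv : ∀ x a, u x a ≠ 0 → Γ.vertexLabel x = Γ.vertexLabel a) : Γ.Relations (Matrix.of u) where
  proj := hu.proj
  conjTranspose_mul := by
    ext a b
    rw [Matrix.mul_apply]
    simp only [Matrix.conjTranspose_apply, Matrix.of_apply, (hu.proj _ _).isSelfAdjoint.star_eq]
    by_cases h : a = b
    · subst h
      simp_rw [(hu.proj _ _).isIdempotentElem.eq, hu.col_sum, Matrix.one_apply_eq]
    · rw [Matrix.one_apply_ne h]
      exact Finset.sum_eq_zero fun x _ => hu.row_orth x a b h
  mul_conjTranspose := by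
    ext x y
    rw [Matrix.mul_apply]
    simp only [Matrix.conjTranspose_apply, Matrix.of_apply, (hu.proj _ _).isSelfAdjoint.star_eq]
    by_cases h : x = y
    · subst h
      simp_rw [(hu.proj _ _).isIdempotentElem.eq, hu.row_sum, Matrix.one_apply_eq]
    · rw [Matrix.one_apply_ne h]
      exact Finset.sum_eq_zero fun a _ => hu.col_orth x y a h
  edge_comm c := by
    classical
    ext x b
    simp only [Matrix.mul_apply, LabelledCompleteDigraph.edgeMatrix, Matrix.of_apply]
    -- Inserting a row sum on one side and a column sum on the other turns both into double sums of
    -- `u x a * u y b` times an indicator. The indicators agree wherever the product is nonzero.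
    trans ∑ a, ∑ y, u x a * u y b *
      if ∃ hxy : x ≠ y, Γ.edgeLabel ⟨(x, y), hxy⟩ = c then 1 else 0
    · rw [Finset.sum_comm]
      refine Finset.sum_congr rfl fun y _ => ?_
      rw [← Finset.sum_mul, ← Finset.sum_mul, hu.row_sum, one_mul, ite_mul, mul_ite, one_mul,
        mul_one, zero_mul, mul_zero]
      congr
    trans ∑ a, ∑ y, u x a * u y b *
      if ∃ hab : a ≠ b, Γ.edgeLabel ⟨(a, b), hab⟩ = c then 1 else 0
    swap
    · refine Finset.sum_congr rfl fun a _ => ?_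
      rw [← Finset.sum_mul, ← Finset.mul_sum, hu.col_sum, mul_one]
      congr
    refine Finset.sum_congr rfl fun a _ => Finset.sum_congr rfl fun y _ => ?_
    by_cases h : u x a * u y b = 0
    · rw [h, zero_mul, zero_mul]
    · have h1 : (∃ hxy : x ≠ y, Γ.edgeLabel ⟨(x, y), hxy⟩ = c) ↔
          ∃ hab : a ≠ b, Γ.edgeLabel ⟨(a, b), hab⟩ = c := by
        constructor
        · rintro ⟨hxy, rfl⟩
          have hab : a ≠ b := by
            rintro rfl
            exact h (hu.col_orth _ _ _ hxy)
          exact ⟨hab, (he _ _ _ _ hxy hab h).symm⟩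
        · rintro ⟨hab, rfl⟩
          have hxy : x ≠ y := by
            rintro rfl
            exact h (hu.row_orth _ _ _ hab)
          exact ⟨hxy, he _ _ _ _ hxy hab h⟩
      rw [if_congr h1 rfl rfl]
  vertex_comm c := by
    ext x a
    rw [Γ.vertexMatrix_mul_apply, Γ.mul_vertexMatrix_apply, Matrix.of_apply]
    by_cases h : u x a = 0
    · rw [h, ite_self, ite_self]
    · rw [hv x a h]

/-- In a representation of the quantum automorphism group of a labelled digraph, the product
`u x a * u y b` vanishes if the labels of `(x, y)` and `(a, b)` differ. -/
theorem mul_eq_zero_of_edgeLabel_ne [DecidableEq W] {L : Type*} {Γ : LabelledCompleteDigraph W L}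
    (hu : Γ.Relations (Matrix.of u)) {x y a b : W} (hxy : x ≠ y) (hab : a ≠ b)
    (h : Γ.edgeLabel ⟨(x, y), hxy⟩ ≠ Γ.edgeLabel ⟨(a, b), hab⟩) : u x a * u y b = 0 := by
  have hm := hu.isMagicUnitary
  have h1 := congrFun (congrFun (hu.edge_comm (Γ.edgeLabel ⟨(x, y), hxy⟩)) x) b
  simp only [Matrix.mul_apply, LabelledCompleteDigraph.edgeMatrix, Matrix.of_apply] at h1
  -- Multiplication by `u x a` and `u y b` isolates one term on each side: the left one carries
  -- coefficient `1`, the right one coefficient `0` because the labels differ.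
  have h2 := congrArg (fun z => u x a * z * u y b) h1
  simp only [Finset.mul_sum, Finset.sum_mul] at h2
  rw [Finset.sum_eq_single y, Finset.sum_eq_single a, if_pos ⟨hxy, rfl⟩, if_neg, one_mul, mul_zero,
    mul_zero, zero_mul, mul_assoc, (hm.proj y b).isIdempotentElem.eq] at h2
  · exact h2
  · rintro ⟨h3, h4⟩
    exact h h4.symm
  · intro a' _ ha'
    rw [← mul_assoc, hm.row_orth _ _ _ ha'.symm, zero_mul, zero_mul]
  · simp
  · intro y' _ hy'
    rw [mul_assoc, mul_assoc, hm.col_orth _ _ _ hy', mul_zero, mul_zero]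
  · simp

theorem eq_zero_of_vertexLabel_ne [DecidableEq W] {L : Type*} {Γ : LabelledCompleteDigraph W L}
    (hu : Γ.Relations (Matrix.of u)) {x a : W} (h : Γ.vertexLabel x ≠ Γ.vertexLabel a) :
    u x a = 0 := by
  have h1 := congrFun (congrFun (hu.vertex_comm (Γ.vertexLabel x)) x) a
  rw [Γ.vertexMatrix_mul_apply, Γ.mul_vertexMatrix_apply, Matrix.of_apply] at h1
  simpa [h.symm] using h1

end IsMagicUnitary

end CStar

/-! ## Compact quantum groups from magic unitaries -/

/-- The subalgebra generated by `S` is dense in the C*-algebra `A`. -/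
def TopologicallyGenerates {A : Type*} [CStarAlgebra A] (S : Set A) : Prop :=
  (Algebra.adjoin ℂ S).topologicalClosure = ⊤

theorem topologicallyGenerates_of_induction {A : Type*} [CStarAlgebra A] {S : Set A}
    (h : ∀ P : A → Prop, IsClosed {x | P x} → (∀ c : ℂ, P (algebraMap ℂ _ c)) →
      (∀ s ∈ S, P s) → (∀ a b, P a → P b → P (a * b)) → (∀ a b, P a → P b → P (a + b)) →
      ∀ x, P x) : TopologicallyGenerates S := by
  rw [TopologicallyGenerates, eq_top_iff]
  intro z _
  exact h (fun z => z ∈ (Algebra.adjoin ℂ S).topologicalClosure)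
    (Subalgebra.isClosed_topologicalClosure _) (fun c => Subalgebra.algebraMap_mem _ c)
    (fun s hs => Subalgebra.le_topologicalClosure _ (Algebra.subset_adjoin hs))
    (fun a b => mul_mem) (fun a b => add_mem) z

theorem Submodule.map_mem_closure_span {V : Type*} [AddCommGroup V] [Module ℂ V]
    [TopologicalSpace V] {S : Set V} (f : V →ₗ[ℂ] V) (hf : Continuous f)
    (h : ∀ s ∈ S, f s ∈ span ℂ S) {z : V} (hz : z ∈ closure (span ℂ S : Set V)) :
    f z ∈ closure (span ℂ S : Set V) := by
  refine map_mem_closure hf hz fun w hw => ?_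
  exact (span_le (p := (span ℂ S).comap f)).mpr h hw

/-- With `i` and `j` the two legs of the tensor product and `D = Δ`, this reduces the cancellation
property to generators. The closed span absorbs `j` on the left and `D` on the right, so only the
elements `i c` are at issue. -/
theorem mul_mem_closure_span_of_generators {A B : Type*} [NormedRing A] [NormedAlgebra ℂ A]
    [NormedRing B] [NormedAlgebra ℂ B] {S : Set A}
    (hS : (Algebra.adjoin ℂ S).topologicalClosure = ⊤) (i j D : A →ₐ[ℂ] B) (hi : Continuous i)
    (hcomm : ∀ a b, Commute (i a) (j b))
    (hgen : ∀ s ∈ S, i s ∈ Submodule.span ℂ {z | ∃ a b, z = j a * D b}) (c d : A) :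
    j d * i c ∈ closure (Submodule.span ℂ {z | ∃ a b, z = j a * D b} : Set B) := by
  set E := Submodule.span ℂ {z | ∃ a b, z = j a * D b} with hE
  have hleft : ∀ d, ∀ z ∈ closure (E : Set B), j d * z ∈ closure (E : Set B) := fun d z hz => by
    refine Submodule.map_mem_closure_span (LinearMap.mulLeft ℂ (j d))
      (continuous_const_mul (j d)) ?_ hz
    rintro _ ⟨a, b, rfl⟩
    refine Submodule.subset_span ⟨d * a, b, ?_⟩
    rw [LinearMap.mulLeft_apply, map_mul, mul_assoc]
  have hright : ∀ d, ∀ z ∈ closure (E : Set B), z * D d ∈ closure (E : Set B) := fun d z hz => by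
    refine Submodule.map_mem_closure_span (LinearMap.mulRight ℂ (D d))
      (continuous_mul_const (D d)) ?_ hz
    rintro _ ⟨a, b, rfl⟩
    refine Submodule.subset_span ⟨a, b * d, ?_⟩
    rw [LinearMap.mulRight_apply, map_mul, mul_assoc]
  refine hleft d _ ?_
  -- Membership of `i c` in the closed span is not visibly multiplicative in `c`. The right
  -- multipliers `m` preserving it do form a closed subalgebra.
  let M : Subalgebra ℂ A :=
    { carrier := {m | ∀ c, i c ∈ E.topologicalClosure → i (c * m) ∈ E.topologicalClosure}
      mul_mem' := fun {a b} ha hb c hc => by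
        rw [← mul_assoc]
        exact hb _ (ha _ hc)
      add_mem' := fun {a b} ha hb c hc => by
        rw [mul_add, map_add]
        exact add_mem (ha c hc) (hb c hc)
      algebraMap_mem' := fun r c hc => by
        rw [← Algebra.commutes, ← Algebra.smul_def, map_smul]
        exact Submodule.smul_mem _ r hc }
  have hMc : IsClosed (M : Set A) := by
    have h : (M : Set A) = ⋂ c, ⋂ _ : i c ∈ E.topologicalClosure,
        {m | i (c * m) ∈ E.topologicalClosure} := by
      ext m
      simp only [Set.mem_iInter]
      rfl
    rw [h]
    exact isClosed_iInter fun c => isClosed_iInter fun _ =>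
      E.isClosed_topologicalClosure.preimage (by fun_prop)
  -- Since the legs commute, `i c * (j a * D b) = j a * (i c * D b)`, which stays in the closed
  -- span.
  have hSM : S ⊆ M := fun s hs c hc => by
    rw [map_mul]
    refine Submodule.span_induction (p := fun z _ => i c * z ∈ E.topologicalClosure) ?_ ?_ ?_ ?_
      (hgen s hs)
    · rintro _ ⟨a, b, rfl⟩
      rw [← mul_assoc, (hcomm c a).eq, mul_assoc]
      exact hleft a _ (hright b _ hc)
    · rw [mul_zero]; exact zero_mem _
    · intro y z _ _ hy hz
      rw [mul_add]; exact add_mem hy hz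
    · intro r z _ hz
      rw [mul_smul_comm]; exact Submodule.smul_mem _ r hz
  have hM : M = ⊤ := by
    rw [eq_top_iff, ← hS]
    exact Subalgebra.topologicalClosure_minimal (Algebra.adjoin_le hSM) hMc
  have h1 : i 1 ∈ E.topologicalClosure :=
    E.le_topologicalClosure (Submodule.subset_span ⟨1, 1, by simp⟩)
  have h2 : c ∈ M := hM ▸ Algebra.mem_top
  have h3 := h2 1 h1
  rwa [one_mul] at h3

namespace MinTensor

variable (A B C : Type u) [CStarAlgebra A] [CStarAlgebra B] [CStarAlgebra C]

/-- `a ↦ a ⊗ 1`. -/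
def inclLeft : A →ₐ[ℂ] MinTensor A B := ofAlg.comp Algebra.TensorProduct.includeLeft

/-- `b ↦ 1 ⊗ b`. -/
def inclRight : B →ₐ[ℂ] MinTensor A B := ofAlg.comp Algebra.TensorProduct.includeRight

theorem continuous_inclLeft : Continuous (inclLeft A B) := continuous_tmulLeft 1

theorem continuous_inclRight : Continuous (inclRight A B) := continuous_tmulRight 1

variable {A B}

theorem inclLeft_apply (a : A) : inclLeft A B a = tmul a 1 := rfl

theorem inclRight_apply (b : B) : inclRight A B b = tmul 1 b := rfl

theorem commute_incl (a : A) (b : B) : Commute (inclLeft A B a) (inclRight A B b) := by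
  rw [Commute, SemiconjBy, inclLeft_apply, inclRight_apply, tmul_mul_tmul, tmul_mul_tmul, one_mul,
    one_mul, mul_one, mul_one]

variable (A B)

/-- `assocGraph` as a subalgebra. -/
def assocSubalgebra :
    Subalgebra ℂ (MinTensor (MinTensor A B) C × MinTensor A (MinTensor B C)) :=
  ((Submodule.span ℂ {z | ∃ a b c, z = (tmul (tmul a b) c, tmul a (tmul b c))}).toSubalgebra
    (Submodule.subset_span ⟨1, 1, 1, by simp only [tmul_one_one]; rfl⟩)
    fun y z hy hz => by
      have h := Submodule.mul_mem_mul hy hz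
      rw [Submodule.span_mul_span] at h
      refine Submodule.span_mono ?_ h
      rintro _ ⟨_, ⟨a, b, c, rfl⟩, _, ⟨a', b', c', rfl⟩, rfl⟩
      refine ⟨a * a', b * b', c * c', ?_⟩
      simp only [Prod.mk_mul_mk, tmul_mul_tmul]).topologicalClosure

end MinTensor

namespace IsMagicUnitary

variable {W : Type*} [Fintype W] {A : Type u} [CStarAlgebra A] {u : W → W → A}

/-- A C*-algebra generated by the entries of a magic unitary `u`, with a comultiplication for which
`u` is a corepresentation, is a compact quantum group. -/
theorem isCompactQuantumGroup (hu : IsMagicUnitary u)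
    (hgen : TopologicallyGenerates (Set.range fun p : W × W => u p.1 p.2))
    {Δ : A →⋆ₐ[ℂ] MinTensor A A} (hΔ : IsMatrixComultiplication u Δ) :
    IsCompactQuantumGroup Δ where
  coassoc a := by
    let F : A →ₐ[ℂ] MinTensor (MinTensor A A) A × MinTensor A (MinTensor A A) :=
      (((MinTensor.map Δ (StarAlgHom.id ℂ A)).comp Δ).toAlgHom).prod
        (((MinTensor.map (StarAlgHom.id ℂ A) Δ).comp Δ).toAlgHom)
    have hF : Continuous F :=
      (((MinTensor.map Δ (StarAlgHom.id ℂ A)).comp Δ).continuous_of_cstar).prodMk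
        (((MinTensor.map (StarAlgHom.id ℂ A) Δ).comp Δ).continuous_of_cstar)
    -- Coassociativity holds on a closed subalgebra, so it is enough to see it on the entries of
    -- `u`.
    have h1 : (MinTensor.assocSubalgebra A A A).comap F = ⊤ := by
      rw [eq_top_iff, ← show _ = _ from hgen]
      refine Subalgebra.topologicalClosure_minimal (Algebra.adjoin_le ?_)
        ((Subalgebra.isClosed_topologicalClosure _).preimage hF)
      rintro _ ⟨⟨x, a⟩, rfl⟩
      change (MinTensor.map Δ (StarAlgHom.id ℂ A) (Δ (u x a)),
        MinTensor.map (StarAlgHom.id ℂ A) Δ (Δ (u x a))) ∈ MinTensor.assocSubalgebra A A A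
      have h2 : (MinTensor.map Δ (StarAlgHom.id ℂ A) (Δ (u x a)),
          MinTensor.map (StarAlgHom.id ℂ A) Δ (Δ (u x a))) =
          ∑ r, ∑ s, (MinTensor.tmul (MinTensor.tmul (u x r) (u r s)) (u s a),
            MinTensor.tmul (u x r) (MinTensor.tmul (u r s) (u s a))) := by
        ext
        · simp only [hΔ x a, map_sum, MinTensor.map_tmul, StarAlgHom.coe_id, id_eq, Prod.fst_sum]
          rw [Finset.sum_comm]
          refine Finset.sum_congr rfl fun s _ => ?_
          rw [hΔ x s, MinTensor.sum_tmul]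
        · simp only [hΔ x a, map_sum, MinTensor.map_tmul, StarAlgHom.coe_id, id_eq, Prod.snd_sum]
          refine Finset.sum_congr rfl fun r _ => ?_
          rw [hΔ r a, MinTensor.tmul_sum]
      rw [h2]
      exact sum_mem fun r _ => sum_mem fun s _ => Subalgebra.le_topologicalClosure _
        (Submodule.subset_span ⟨_, _, _, rfl⟩)
    exact (SetLike.ext_iff.mp h1 a).mpr Algebra.mem_top
  dense_one_tmul := by
    refine MinTensor.dense_of_tmul_mem fun c d => ?_
    have h := mul_mem_closure_span_of_generators hgen (MinTensor.inclLeft A A)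
      (MinTensor.inclRight A A) Δ.toAlgHom (MinTensor.continuous_inclLeft A A)
      MinTensor.commute_incl ?_ c d
    · rw [MinTensor.inclLeft_apply, MinTensor.inclRight_apply, MinTensor.tmul_mul_tmul, one_mul,
        mul_one] at h
      exact h
    rintro _ ⟨⟨x, y⟩, rfl⟩
    -- In the expansion column orthogonality keeps only `r = y`, and the row sum of `u y a` gives
    -- `1`. Here `u y a` plays the role of the antipode of `u a y`.
    have h1 : MinTensor.inclLeft A A (u x y) =
        ∑ a, MinTensor.inclRight A A (u y a) * Δ (u x a) := by
      simp only [hΔ x _, MinTensor.mul_sum, MinTensor.inclRight_apply, MinTensor.tmul_mul_tmul,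
        one_mul]
      rw [Finset.sum_comm, Finset.sum_eq_single y]
      · simp_rw [(hu.proj y _).isIdempotentElem.eq]
        rw [← MinTensor.tmul_sum, hu.row_sum]
        rfl
      · intro r _ hr
        simp [hu.col_orth y r _ hr.symm, MinTensor.tmul_zero]
      · simp
    rw [h1]
    exact sum_mem fun a _ => Submodule.subset_span ⟨_, _, rfl⟩
  dense_tmul_one := by
    refine MinTensor.dense_of_tmul_mem fun d c => ?_
    have h := mul_mem_closure_span_of_generators hgen (MinTensor.inclRight A A)
      (MinTensor.inclLeft A A) Δ.toAlgHom (MinTensor.continuous_inclRight A A)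
      (fun a b => (MinTensor.commute_incl b a).symm) ?_ c d
    · rw [MinTensor.inclLeft_apply, MinTensor.inclRight_apply, MinTensor.tmul_mul_tmul, one_mul,
        mul_one] at h
      exact h
    rintro _ ⟨⟨y, a⟩, rfl⟩
    have h1 : MinTensor.inclRight A A (u y a) =
        ∑ x, MinTensor.inclLeft A A (u x y) * Δ (u x a) := by
      simp only [hΔ _ a, MinTensor.mul_sum, MinTensor.inclLeft_apply, MinTensor.tmul_mul_tmul,
        one_mul]
      rw [Finset.sum_comm, Finset.sum_eq_single y]
      · simp_rw [(hu.proj _ y).isIdempotentElem.eq]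
        rw [← MinTensor.sum_tmul, hu.col_sum]
        rfl
      · intro r _ hr
        simp [hu.row_orth _ y r hr.symm, MinTensor.zero_tmul]
      · simp
    rw [h1]
    exact sum_mem fun a _ => Submodule.subset_span ⟨_, _, rfl⟩

/-- The projection `u x s ⊗ u s a` lies below `Δ (u x a)`. Hence the nonzero tensor of the two given
products contains `Δ (u p.1 r.1 * u p.2 r.2)` as a factor, and that product cannot vanish. -/
theorem orbitalRel_trans (hA : IsNormedByReps.{u} A) (hu : IsMagicUnitary u)
    {Δ : A →⋆ₐ[ℂ] MinTensor A A} (hΔ : IsMatrixComultiplication u Δ) {p q r : W × W}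
    (hpq : OrbitalRel u p q) (hqr : OrbitalRel u q r) : OrbitalRel u p r := by
  intro h
  have h1 : ∀ x s a, MinTensor.tmul (u x s) (u s a) * Δ (u x a) =
      MinTensor.tmul (u x s) (u s a) := fun x s a => by
    rw [hΔ, MinTensor.mul_sum, Finset.sum_eq_single s]
    · rw [MinTensor.tmul_mul_tmul, (hu.proj x s).isIdempotentElem.eq,
        (hu.proj s a).isIdempotentElem.eq]
    · intro t _ ht
      rw [MinTensor.tmul_mul_tmul, hu.row_orth _ _ _ ht.symm, MinTensor.zero_tmul]
    · simp
  have h2 : ∀ x s a, Δ (u x a) * MinTensor.tmul (u x s) (u s a) =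
      MinTensor.tmul (u x s) (u s a) := fun x s a => by
    rw [hΔ, MinTensor.sum_mul, Finset.sum_eq_single s]
    · rw [MinTensor.tmul_mul_tmul, (hu.proj x s).isIdempotentElem.eq,
        (hu.proj s a).isIdempotentElem.eq]
    · intro t _ ht
      rw [MinTensor.tmul_mul_tmul, hu.row_orth _ _ _ ht, MinTensor.zero_tmul]
    · simp
  refine MinTensor.tmul_ne_zero hA hA hpq hqr ?_
  rw [← MinTensor.tmul_mul_tmul, ← h1 p.1, ← h2 p.2, mul_assoc, ← mul_assoc (Δ _), ← map_mul, h,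
    map_zero, zero_mul, mul_zero]

end IsMagicUnitary
/-! ## Perfect quantum strategies and representations -/

namespace QuantumStrategy

variable {W : Type*} [Fintype W] (S : QuantumStrategy W W W W)

/-- Alice's projections on the composite system. -/
def left (x a : W) : S.HA ⊗[ℂ] S.HB →L[ℂ] S.HA ⊗[ℂ] S.HB :=
  TensorProduct.mapL (S.P x a) (.id ℂ _)

/-- Bob's projections on the composite system. -/
def right (y b : W) : S.HA ⊗[ℂ] S.HB →L[ℂ] S.HA ⊗[ℂ] S.HB :=
  TensorProduct.mapL (.id ℂ _) (S.Q y b)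

theorem left_proj (x a : W) : IsStarProjection (S.left x a) where
  isIdempotentElem := by
    rw [IsIdempotentElem, left, ← ContinuousLinearMap.one_def, ← TensorProduct.mapL_mul,
      (S.P_proj x a).isIdempotentElem.eq, one_mul]
  isSelfAdjoint := by
    rw [IsSelfAdjoint, left, ContinuousLinearMap.star_eq_adjoint, TensorProduct.adjoint_mapL,
      ← ContinuousLinearMap.star_eq_adjoint, (S.P_proj x a).isSelfAdjoint.star_eq,
      ContinuousLinearMap.adjoint_id]

theorem right_proj (y b : W) : IsStarProjection (S.right y b) where
  isIdempotentElem := by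
    rw [IsIdempotentElem, right, ← ContinuousLinearMap.one_def, ← TensorProduct.mapL_mul,
      (S.Q_proj y b).isIdempotentElem.eq, one_mul]
  isSelfAdjoint := by
    rw [IsSelfAdjoint, right, ContinuousLinearMap.star_eq_adjoint, TensorProduct.adjoint_mapL,
      ← ContinuousLinearMap.star_eq_adjoint (S.Q y b), (S.Q_proj y b).isSelfAdjoint.star_eq,
      ContinuousLinearMap.adjoint_id]

theorem left_sum (x : W) : ∑ a, S.left x a = 1 := by
  refine ContinuousLinearMap.coe_injective (TensorProduct.ext' fun v w => ?_)
  have h := congrArg (fun T : S.HA →L[ℂ] S.HA => T v) (S.P_sum x)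
  simp only [sum_apply] at h
  simp [left, ← TensorProduct.sum_tmul, h]

theorem right_sum (y : W) : ∑ b, S.right y b = 1 := by
  refine ContinuousLinearMap.coe_injective (TensorProduct.ext' fun v w => ?_)
  have h := congrArg (fun T : S.HB →L[ℂ] S.HB => T w) (S.Q_sum y)
  simp only [sum_apply] at h
  simp [right, ← TensorProduct.tmul_sum, h]

theorem left_mul_mapL (x a : W) (Y : S.HB →L[ℂ] S.HB) :
    S.left x a * TensorProduct.mapL (.id ℂ _) Y = TensorProduct.mapL (.id ℂ _) Y * S.left x a := by
  refine ContinuousLinearMap.coe_injective (TensorProduct.ext' fun v w => ?_)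
  simp [left]

theorem left_mul_right (x a y b : W) : S.left x a * S.right y b = S.right y b * S.left x a :=
  S.left_mul_mapL x a (S.Q y b)

/-- The two projections commute, so their product is a projection; its expectation in `ψ` is the
squared norm of its value at `ψ`. -/
theorem left_right_ψ_eq_zero {G : NonlocalGame W W W W} (hS : S.IsPerfect G) {a b x y : W}
    (h : G.V a b x y = false) : S.left x a (S.right y b S.ψ) = 0 := by
  have h1 : S.left x a * S.right y b = TensorProduct.mapL (S.P x a) (S.Q y b) := by
    rw [left, right, ← TensorProduct.mapL_mul]
    rfl
  have h2 : inner ℂ S.ψ ((S.left x a * S.right y b) S.ψ) = 0 := by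
    rw [h1]; exact hS a b x y h
  have h3 : IsStarProjection (S.left x a * S.right y b) :=
    (S.left_proj x a).mul (S.right_proj y b) (S.left_mul_right x a y b)
  change (S.left x a * S.right y b) S.ψ = 0
  rw [← inner_self_eq_zero (𝕜 := ℂ), ← ContinuousLinearMap.adjoint_inner_right,
    ← ContinuousLinearMap.star_eq_adjoint, h3.isSelfAdjoint.star_eq, ← mul_apply_eq_comp,
    h3.isIdempotentElem.eq, h2]

/-- Both sides equal `S.left x a (S.right x a S.ψ)`: expand `1` over the answers of the other
player; synchronicity kills the unequal ones. -/
theorem left_ψ_eq_right_ψ {G : NonlocalGame W W W W} (hG : G.IsSynchronous) (hS : S.IsPerfect G)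
    (x a : W) : S.left x a S.ψ = S.right x a S.ψ := by
  classical
  have h1 : S.left x a S.ψ = S.left x a (S.right x a S.ψ) := by
    have h := congrArg (fun T => S.left x a (T S.ψ)) (S.right_sum x)
    simp only [sum_apply, map_sum, one_apply_eq_self] at h
    rw [← h, Finset.sum_eq_single a (fun b _ hb => S.left_right_ψ_eq_zero hS (hG x a b hb.symm))
      (by simp)]
  have h2 : S.right x a S.ψ = S.left x a (S.right x a S.ψ) := by
    have h := congrArg (fun T => T (S.right x a S.ψ)) (S.left_sum x)
    simp only [sum_apply, one_apply_eq_self] at h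
    exact h.symm.trans (Finset.sum_eq_single a
      (fun b _ hb => S.left_right_ψ_eq_zero hS (hG x b a hb)) (by simp))
  rw [h1, ← h2]

/-- The map `Y ↦ (1 ⊗ Y) ψ`. -/
def orbitMap : (S.HB →L[ℂ] S.HB) →ₗ[ℂ] S.HA ⊗[ℂ] S.HB where
  toFun Y := TensorProduct.mapL (.id ℂ _) Y S.ψ
  map_add' Y Z := by rw [TensorProduct.mapL_add_right]; rfl
  map_smul' c Y := by rw [TensorProduct.mapL_smul_right]; rfl

theorem orbitMap_apply (Y : S.HB →L[ℂ] S.HB) :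
    S.orbitMap Y = TensorProduct.mapL (.id ℂ _) Y S.ψ := rfl

/-- This makes the range of `orbitMap` invariant under the projections of Alice. -/
theorem left_orbitMap {G : NonlocalGame W W W W} (hG : G.IsSynchronous) (hS : S.IsPerfect G)
    (x a : W) (Y : S.HB →L[ℂ] S.HB) : S.left x a (S.orbitMap Y) = S.orbitMap (Y * S.Q x a) := by
  rw [orbitMap_apply, ← mul_apply_eq_comp, left_mul_mapL,
    mul_apply_eq_comp, S.left_ψ_eq_right_ψ hG hS, right,
    ← mul_apply_eq_comp, ← TensorProduct.mapL_mul]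
  rfl

/-- Operators of Bob move past those of Alice, and at `ψ` the inner projection of Alice may be
replaced by that of Bob. What remains is a losing event. -/
theorem left_left_orbitMap {G : NonlocalGame W W W W} (hG : G.IsSynchronous) (hS : S.IsPerfect G)
    {a b x y : W} (h : G.V a b x y = false) (Y : S.HB →L[ℂ] S.HB) :
    S.left x a (S.left y b (S.orbitMap Y)) = 0 := by
  rw [orbitMap_apply, ← mul_apply_eq_comp (S.left y b), left_mul_mapL,
    mul_apply_eq_comp, ← mul_apply_eq_comp, left_mul_mapL,
    mul_apply_eq_comp, S.left_ψ_eq_right_ψ hG hS y b, S.left_right_ψ_eq_zero hS h,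
    map_zero]

end QuantumStrategy

/-- A compression of a star projection to an invariant subspace is a star projection. -/
theorem IsStarProjection.adjoint_comp_comp {E F : Type*} [NormedAddCommGroup E]
    [InnerProductSpace ℂ E] [CompleteSpace E] [NormedAddCommGroup F] [InnerProductSpace ℂ F]
    [CompleteSpace F] {p : F →L[ℂ] F} (hp : IsStarProjection p) {j : E →L[ℂ] F}
    (hj : j ∘L j.adjoint ∘L p ∘L j = p ∘L j) : IsStarProjection (j.adjoint ∘L p ∘L j) where
  isIdempotentElem := by
    change (j.adjoint ∘L p) ∘L (j ∘L j.adjoint ∘L p ∘L j) = _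
    rw [hj]
    change j.adjoint ∘L (p * p) ∘L j = _
    rw [hp.isIdempotentElem.eq]
  isSelfAdjoint := by
    rw [IsSelfAdjoint, ContinuousLinearMap.star_eq_adjoint, ContinuousLinearMap.adjoint_comp,
      ContinuousLinearMap.adjoint_comp, ContinuousLinearMap.adjoint_adjoint,
      ← ContinuousLinearMap.star_eq_adjoint p, hp.isSelfAdjoint.star_eq]
    rfl

/-- A finite-dimensional Hilbert space is isometric to a Hilbert space in `Type u`. -/
theorem exists_linearIsometryEquiv_euclideanSpace (K : Type*) [NormedAddCommGroup K]
    [InnerProductSpace ℂ K] [FiniteDimensional ℂ K] : ∃ n : ℕ,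
    Nonempty (EuclideanSpace ℂ (ULift.{u} (Fin n)) ≃ₗᵢ[ℂ] K) :=
  ⟨_, ⟨((stdOrthonormalBasis ℂ K).reindex Equiv.ulift.symm).repr.symm⟩⟩

/-- A synchronous game with a perfect quantum strategy has a nonzero algebra. -/
theorem NonlocalGame.nontrivial_cstar {W : Type u} [Fintype W] {G : NonlocalGame W W W W}
    (hG : G.IsSynchronous) (hq : G.HasPerfectQuantumStrategy) : Nontrivial G.CStar := by
  obtain ⟨S, hS⟩ := hq
  let K : Submodule ℂ (S.HA ⊗[ℂ] S.HB) := LinearMap.range S.orbitMap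
  -- Representations of the relations live in `Type u`, so the invariant subspace is replaced by an
  -- isometric copy there.
  obtain ⟨n, ⟨e⟩⟩ := exists_linearIsometryEquiv_euclideanSpace.{u} K
  let E := EuclideanSpace ℂ (ULift.{u} (Fin n))
  let j₀ : E →ₗᵢ[ℂ] S.HA ⊗[ℂ] S.HB := K.subtypeₗᵢ.comp e.toLinearIsometry
  let j : E →L[ℂ] S.HA ⊗[ℂ] S.HB := j₀.toContinuousLinearMap
  have hjj : j.adjoint ∘L j = 1 := j₀.adjoint_comp_self
  have hjmem : ∀ v, ∃ Y, S.orbitMap Y = j v := fun v => (e v).2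
  have hrange : ∀ k ∈ K, ∃ v, j v = k := fun k hk =>
    ⟨e.symm ⟨k, hk⟩, congrArg Subtype.val (e.apply_symm_apply ⟨k, hk⟩)⟩
  have hj : ∀ x a, j ∘L j.adjoint ∘L S.left x a ∘L j = S.left x a ∘L j := fun x a => by
    ext1 v
    obtain ⟨Y, hY⟩ := hjmem v
    obtain ⟨w, hw⟩ := hrange (S.left x a (j v))
      ⟨_, by rw [← hY]; exact (S.left_orbitMap hG hS x a Y).symm⟩
    simp only [ContinuousLinearMap.comp_apply]
    rw [← hw]
    exact congrArg j (congrArg (fun T : E →L[ℂ] E => T w) hjj)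
  have hrel : G.Relations fun x a => j.adjoint ∘L S.left x a ∘L j :=
    { proj := fun x a => (S.left_proj x a).adjoint_comp_comp (hj x a)
      sum_eq_one := fun x => by
        rw [← hjj]
        ext1 v
        have h := congrArg (fun T => j.adjoint (T (j v))) (S.left_sum x)
        simp only [sum_apply, map_sum, one_apply_eq_self] at h
        simp only [sum_apply, ContinuousLinearMap.comp_apply, h]
      mul_eq_zero := fun a b x y hV => by
        change (j.adjoint ∘L S.left x a) ∘L (j ∘L j.adjoint ∘L S.left y b ∘L j) = 0
        rw [hj]
        ext1 v
        obtain ⟨Y, hY⟩ := hjmem v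
        simp only [ContinuousLinearMap.comp_apply]
        rw [← hY, S.left_left_orbitMap hG hS hV, map_zero]
        rfl }
  let r : G.cstarRelations.Rep := ⟨E, fun p => j.adjoint ∘L S.left p.1 p.2 ∘L j, hrel⟩
  -- The unit vector `ψ` lies in the subspace, so the representation space is nonzero.
  have hψ : S.ψ ∈ K := ⟨.id ℂ _, by rw [S.orbitMap_apply]; simp⟩
  obtain ⟨v, hv⟩ := hrange _ hψ
  refine nontrivial_of_ne 1 0 fun h => ?_
  have h1 : (1 : E →L[ℂ] E) = 0 := by
    have h2 := congrArg r.toHom h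
    rwa [map_one, map_zero] at h2
  have h3 : v = 0 := congrArg (fun T : E →L[ℂ] E => T v) h1
  have h4 := S.norm_ψ
  rw [← hv, h3, map_zero, norm_zero] at h4
  exact zero_ne_one h4
/-! ## The algebras of a bisynchronous transitive game and of its orbital graph -/

theorem NonlocalGame.Relations.map {I O : Type*} [Fintype O] {G : NonlocalGame I I O O}
    {R R' : Type*} [Ring R] [StarRing R] [Algebra ℂ R] [Ring R'] [StarRing R'] [Algebra ℂ R']
    {u : I → O → R} (hu : G.Relations u) (f : R →⋆ₐ[ℂ] R') : G.Relations fun x a => f (u x a) where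
  proj x a := (hu.proj x a).map f
  sum_eq_one x := by rw [← map_sum, hu.sum_eq_one, map_one]
  mul_eq_zero a b x y h := by rw [← map_mul, hu.mul_eq_zero a b x y h, map_zero]

theorem NonlocalGame.relations_gen {I O : Type u} [Fintype O] (G : NonlocalGame I I O O) :
    G.Relations G.gen where
  proj x a := by
    change IsStarProjection (G.cstarRelations.ofFree (FreeStarAlgebra.gen (x, a)))
    refine ⟨?_, ?_⟩
    · rw [IsIdempotentElem, ← map_mul]
      refine G.cstarRelations.ofFree_eq fun r => ?_
      rw [map_mul, FreeStarAlgebra.lift_gen]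
      exact (r.holds.proj x a).isIdempotentElem
    · rw [IsSelfAdjoint, ← map_star]
      refine G.cstarRelations.ofFree_eq fun r => ?_
      rw [map_star, FreeStarAlgebra.lift_gen]
      exact (r.holds.proj x a).isSelfAdjoint
  sum_eq_one x := by
    change ∑ a, G.cstarRelations.ofFree (FreeStarAlgebra.gen (x, a)) = 1
    rw [← map_sum, ← map_one G.cstarRelations.ofFree]
    refine G.cstarRelations.ofFree_eq fun r => ?_
    rw [map_sum, map_one, ← r.holds.sum_eq_one x]
    exact Finset.sum_congr rfl fun a _ => FreeStarAlgebra.lift_gen r.T (x, a)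
  mul_eq_zero a b x y h := by
    change G.cstarRelations.ofFree (FreeStarAlgebra.gen (x, a)) *
      G.cstarRelations.ofFree (FreeStarAlgebra.gen (y, b)) = 0
    rw [← map_mul]
    refine G.cstarRelations.ofFree_eq_zero fun r => ?_
    rw [map_mul, FreeStarAlgebra.lift_gen, FreeStarAlgebra.lift_gen]
    exact r.holds.mul_eq_zero a b x y h

/-- Self-adjointness lets adjoints of the generators be omitted from the generating set. -/
theorem CStarRelations.topologicallyGenerates_gen {X : Type u} (R : CStarRelations X)
    (h : ∀ x, IsSelfAdjoint (R.gen x)) : TopologicallyGenerates (Set.range R.gen) :=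
  topologicallyGenerates_of_induction fun _ hc h1 hs hm ha =>
    R.isClosed_induction hc h1 (fun x => hs _ ⟨x, rfl⟩)
      (fun x => by rw [(h x).star_eq]; exact hs _ ⟨x, rfl⟩) hm ha

/-! ### The comultiplication of a transitive game -/

section Comultiplication

variable {W : Type u} [Fintype W] {A : Type u} [CStarAlgebra A] {u : W → W → A}

/-- The matrix `∑ r, u x r ⊗ u r a`. -/
def comulMatrix (u : W → W → A) (x a : W) : MinTensor A A :=
  ∑ r, MinTensor.tmul (u x r) (u r a)

/-- For the zero products, consider a term `(u x r * u y s) ⊗ (u r a * u s b)`. If both `V(r,s|x,y)`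
and `V(a,b|r,s)` were `1`, transitivity would give `V(a,b|x,y) = 1`; so one leg vanishes. -/
theorem NonlocalGame.Relations.comulMatrix {G : NonlocalGame W W W W}
    (hG : G.IsSynchronous) (ht : G.IsTransitive) (hu : G.Relations u) :
    G.Relations (comulMatrix u) where
  proj x a := by
    classical
    refine ⟨?_, ?_⟩
    · rw [IsIdempotentElem, _root_.comulMatrix, MinTensor.sum_mul]
      refine Finset.sum_congr rfl fun r _ => ?_
      rw [MinTensor.mul_sum, Finset.sum_eq_single r]
      · rw [MinTensor.tmul_mul_tmul, (hu.proj x r).isIdempotentElem.eq,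
          (hu.proj r a).isIdempotentElem.eq]
      · intro s _ hs
        rw [MinTensor.tmul_mul_tmul, hu.mul_eq_zero _ _ _ _ (hG x r s hs.symm),
          MinTensor.zero_tmul]
      · simp
    · rw [IsSelfAdjoint, _root_.comulMatrix]
      refine (star_sum _ _).trans (Finset.sum_congr rfl fun r _ => ?_)
      rw [MinTensor.star_tmul, (hu.proj x r).isSelfAdjoint.star_eq,
        (hu.proj r a).isSelfAdjoint.star_eq]
  sum_eq_one x := by
    simp only [_root_.comulMatrix]
    refine Finset.sum_comm.trans ?_
    simp_rw [← MinTensor.tmul_sum, hu.sum_eq_one]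
    rw [← MinTensor.sum_tmul, hu.sum_eq_one, MinTensor.tmul_one_one]
  mul_eq_zero a b x y h := by
    rw [_root_.comulMatrix, _root_.comulMatrix, MinTensor.sum_mul]
    refine Finset.sum_eq_zero fun r _ => ?_
    rw [MinTensor.mul_sum]
    refine Finset.sum_eq_zero fun s _ => ?_
    rw [MinTensor.tmul_mul_tmul]
    by_cases h1 : G.V r s x y = true
    · have h2 : G.V a b r s = false := by
        by_contra h2
        rw [ht a b r s x y (by simpa using h2) h1] at h
        exact Bool.noConfusion h
      rw [hu.mul_eq_zero a b r s h2, MinTensor.tmul_zero]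
    · rw [hu.mul_eq_zero r s x y (by simpa using h1), MinTensor.zero_tmul]

end Comultiplication

namespace NonlocalGame

variable {W : Type u} [Fintype W] (G : NonlocalGame W W W W)

/-- The comultiplication of the algebra of a synchronous transitive game. -/
def comul (hG : G.IsSynchronous) (ht : G.IsTransitive) :
    G.CStar →⋆ₐ[ℂ] MinTensor G.CStar G.CStar :=
  G.cstarRelations.lift (MinTensor.isNormedByReps _ _) (fun p => comulMatrix G.gen p.1 p.2)
    fun _ _ _ _ ρ => (G.relations_gen.comulMatrix hG ht).map ρ

theorem isMatrixComultiplication_comul (hG : G.IsSynchronous) (ht : G.IsTransitive) :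
    IsMatrixComultiplication G.gen (G.comul hG ht) := fun x a =>
  G.cstarRelations.lift_gen (MinTensor.isNormedByReps _ _)
    (fun p => comulMatrix G.gen p.1 p.2) _ (x, a)

end NonlocalGame

/-! ### Relations of a labelled digraph under homomorphisms -/

namespace LabelledCompleteDigraph

variable {W : Type u} {L : Type*} {Γ : LabelledCompleteDigraph W L}

theorem edgeMatrix_map {R R' F : Type*} [Ring R] [Ring R'] [FunLike F R R']
    [RingHomClass F R R'] (f : F) (c : L) : (Γ.edgeMatrix R c).map f = Γ.edgeMatrix R' c := by
  ext x y
  simp only [edgeMatrix, Matrix.map_apply, Matrix.of_apply]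
  split_ifs
  · exact map_one f
  · exact map_zero f

theorem vertexMatrix_map {R R' F : Type*} [Ring R] [Ring R'] [FunLike F R R']
    [RingHomClass F R R'] (f : F) (c : L) : (Γ.vertexMatrix R c).map f = Γ.vertexMatrix R' c := by
  ext x y
  simp only [vertexMatrix, Matrix.map_apply, Matrix.diagonal_apply]
  split_ifs
  · exact map_one f
  · exact map_zero f
  · exact map_zero f

variable [Fintype W] [DecidableEq W]

/-- The relations hold for the image of `U` under `f` if they hold for the images under a family of
*-homomorphisms whose common kernel is contained in that of `f`. -/
theorem relations_map_of_forall {ι F R : Type*} {B : ι → Type*} [Ring F] [StarRing F]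
    [Algebra ℂ F] [Ring R] [StarRing R] [Algebra ℂ R] [∀ i, Ring (B i)] [∀ i, StarRing (B i)]
    [∀ i, Algebra ℂ (B i)] {f : F →⋆ₐ[ℂ] R} {g : ∀ i, F →⋆ₐ[ℂ] B i} {U : Matrix W W F}
    (h : ∀ a b, (∀ i, g i a = g i b) → f a = f b) (hg : ∀ i, Γ.Relations (U.map (g i))) :
    Γ.Relations (U.map f) := by
  have key : ∀ M N : Matrix W W F, (∀ i, M.map (g i) = N.map (g i)) → M.map f = N.map f :=
    fun M N hMN => by
      ext x y
      exact h _ _ fun i => congrFun (congrFun (hMN i) x) y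
  have hstar : Uᴴ.map f = (U.map f)ᴴ := Matrix.ext fun x a => map_star f (U a x)
  have hstar' : ∀ i, Uᴴ.map (g i) = (U.map (g i))ᴴ := fun i =>
    Matrix.ext fun x a => map_star (g i) (U a x)
  refine ⟨fun x a => ⟨?_, ?_⟩, ?_, ?_, fun c => ?_, fun c => ?_⟩
  · rw [IsIdempotentElem, Matrix.map_apply, ← map_mul]
    exact h _ _ fun i => by rw [map_mul]; exact ((hg i).proj x a).isIdempotentElem
  · rw [IsSelfAdjoint, Matrix.map_apply, ← map_star]
    exact h _ _ fun i => by rw [map_star]; exact ((hg i).proj x a).isSelfAdjoint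
  · rw [← hstar, ← Matrix.map_mul, ← Matrix.map_one f (map_zero f) (map_one f)]
    refine key _ _ fun i => ?_
    rw [Matrix.map_mul, hstar', Matrix.map_one _ (map_zero (g i)) (map_one (g i))]
    exact (hg i).conjTranspose_mul
  · rw [← hstar, ← Matrix.map_mul, ← Matrix.map_one f (map_zero f) (map_one f)]
    refine key _ _ fun i => ?_
    rw [Matrix.map_mul, hstar', Matrix.map_one _ (map_zero (g i)) (map_one (g i))]
    exact (hg i).mul_conjTranspose
  · rw [← edgeMatrix_map f, ← Matrix.map_mul, ← Matrix.map_mul]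
    refine key _ _ fun i => ?_
    rw [Matrix.map_mul, Matrix.map_mul, edgeMatrix_map]
    exact (hg i).edge_comm c
  · rw [← vertexMatrix_map f, ← Matrix.map_mul, ← Matrix.map_mul]
    refine key _ _ fun i => ?_
    rw [Matrix.map_mul, Matrix.map_mul, vertexMatrix_map]
    exact (hg i).vertex_comm c

theorem Relations.map {R R' : Type*} [Ring R] [StarRing R] [Algebra ℂ R] [Ring R'] [StarRing R']
    [Algebra ℂ R'] {U : Matrix W W R} (hU : Γ.Relations U) (f : R →⋆ₐ[ℂ] R') :
    Γ.Relations (U.map f) :=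
  relations_map_of_forall (ι := Unit) (g := fun _ => StarAlgHom.id ℂ R)
    (fun _ _ h => congrArg f (h ())) fun _ => hU

variable (Γ) in
theorem relations_qutGen : Γ.Relations (Matrix.of Γ.qutGen) := by
  refine relations_map_of_forall (f := Γ.cstarRelations.ofFree)
    (g := fun r : Γ.cstarRelations.Rep => FreeStarAlgebra.lift r.T)
    (U := Matrix.of fun x a => FreeStarAlgebra.gen (x, a))
    (fun _ _ => Γ.cstarRelations.ofFree_eq) fun r => ?_
  have h : (Matrix.of fun x a => FreeStarAlgebra.gen (x, a)).map (FreeStarAlgebra.lift r.T) =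
      Matrix.of fun x a => r.T (x, a) :=
    Matrix.ext fun x a => FreeStarAlgebra.lift_gen r.T (x, a)
  rw [h]
  exact r.holds

end LabelledCompleteDigraph

/-! ## The isomorphism -/

section Orbital

variable {W : Type u} [Fintype W] [DecidableEq W]

/-- Every magic unitary whose orbital relation is an equivalence relation satisfies the relations of
the quantum automorphism group of its orbital graph. -/
theorem IsMagicUnitary.relations_orbitalGraph {A : Type*} [CStarAlgebra A] {u : W → W → A}
    (hu : IsMagicUnitary u) (he : Equivalence (OrbitalRel u)) :
    (orbitalGraph u).Relations (Matrix.of u) := by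
  have horb : ∀ {p q}, OrbitalRel u p q → orbital u p = orbital u q := fun h =>
    Set.ext fun r => ⟨fun hr => he.trans (he.symm h) hr, fun hr => he.trans h hr⟩
  refine hu.relations_of_label_eq (fun x y a b _ _ h => horb h) fun x a h => horb ?_
  rw [OrbitalRel, (hu.proj x a).isIdempotentElem.eq]
  exact h

/-- If `v` satisfies the relations of the quantum automorphism group of the orbital graph of `u`,
then `v x a * v y b` vanishes whenever `u x a * u y b` does. -/
theorem mul_eq_zero_of_relations_orbitalGraph {A B : Type*} [CStarAlgebra A] [CStarAlgebra B]
    {u : W → W → A} {v : W → W → B} (he : Equivalence (OrbitalRel u))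
    (hv : (orbitalGraph u).Relations (Matrix.of v)) {x y a b : W} (h : u x a * u y b = 0) :
    v x a * v y b = 0 := by
  have hm := hv.isMagicUnitary
  -- By reflexivity `(a, b)` lies in its own orbital, but by `h` not in that of `(x, y)`.
  have hne : orbital u (x, y) ≠ orbital u (a, b) := fun h1 => by
    have h2 : (a, b) ∈ orbital u (x, y) := h1 ▸ he.refl (a, b)
    exact h2 h
  -- Labels compare vertices with vertices and edges with edges; the mixed cases are orthogonality
  -- within a row or column.
  by_cases hxy : x = y
  · subst hxy
    by_cases hab : a = b
    · subst hab
      rw [IsMagicUnitary.eq_zero_of_vertexLabel_ne hv hne, zero_mul]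
    · exact hm.row_orth _ _ _ hab
  · by_cases hab : a = b
    · subst hab
      exact hm.col_orth _ _ _ hxy
    · exact IsMagicUnitary.mul_eq_zero_of_edgeLabel_ne hv hxy hab hne

theorem NonlocalGame.relations_qutGen {G : NonlocalGame W W W W}
    (he : Equivalence (OrbitalRel G.gen)) : G.Relations (orbitalGraph G.gen).qutGen := by
  have hv := (orbitalGraph G.gen).relations_qutGen
  exact
    { proj := hv.proj
      sum_eq_one := hv.isMagicUnitary.row_sum
      mul_eq_zero := fun a b x y h => mul_eq_zero_of_relations_orbitalGraph
        he hv (G.relations_gen.mul_eq_zero a b x y h) }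

variable {G : NonlocalGame W W W W}

/-- The *-homomorphism `u x a ↦ v x a`. -/
def NonlocalGame.toQut (he : Equivalence (OrbitalRel G.gen)) :
    G.CStar →⋆ₐ[ℂ] (orbitalGraph G.gen).Qut :=
  G.cstarRelations.lift (CStarRelations.isNormedByReps _)
    (fun p => (orbitalGraph G.gen).qutGen p.1 p.2)
    fun _ _ _ _ ρ => (NonlocalGame.relations_qutGen he).map ρ

theorem NonlocalGame.toQut_gen (he : Equivalence (OrbitalRel G.gen)) (x a : W) :
    toQut he (G.gen x a) = (orbitalGraph G.gen).qutGen x a :=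
  G.cstarRelations.lift_gen (CStarRelations.isNormedByReps _)
    (fun p => (orbitalGraph G.gen).qutGen p.1 p.2)
    (fun _ _ _ _ ρ => (NonlocalGame.relations_qutGen he).map ρ) (x, a)

/-- The *-homomorphism `v x a ↦ u x a`. -/
def NonlocalGame.ofQut (hG : G.IsBisynchronous) (he : Equivalence (OrbitalRel G.gen)) :
    (orbitalGraph G.gen).Qut →⋆ₐ[ℂ] G.CStar :=
  (orbitalGraph G.gen).cstarRelations.lift (CStarRelations.isNormedByReps _)
    (fun p => G.gen p.1 p.2)
    fun _ _ _ _ ρ => ((G.relations_gen.isMagicUnitary hG).relations_orbitalGraph he).map ρ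

theorem NonlocalGame.ofQut_qutGen (hG : G.IsBisynchronous) (he : Equivalence (OrbitalRel G.gen))
    (x a : W) : ofQut hG he ((orbitalGraph G.gen).qutGen x a) = G.gen x a :=
  (orbitalGraph G.gen).cstarRelations.lift_gen (CStarRelations.isNormedByReps _)
    (fun p => G.gen p.1 p.2)
    (fun _ _ _ _ ρ => ((G.relations_gen.isMagicUnitary hG).relations_orbitalGraph he).map ρ) (x, a)

/-- The isomorphism of the algebra of a bisynchronous game with the quantum automorphism group of
its orbital graph. -/
def NonlocalGame.equivQut (hG : G.IsBisynchronous) (he : Equivalence (OrbitalRel G.gen)) :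
    G.CStar ≃⋆ₐ[ℂ] (orbitalGraph G.gen).Qut :=
  StarAlgEquiv.ofStarAlgHom (toQut he) (ofQut hG he)
    (CStarRelations.hom_ext _ fun p =>
      (congrArg (ofQut hG he) (toQut_gen he p.1 p.2)).trans (ofQut_qutGen hG he p.1 p.2))
    (CStarRelations.hom_ext _ fun p =>
      (congrArg (toQut he) (ofQut_qutGen hG he p.1 p.2)).trans (toQut_gen he p.1 p.2))

theorem NonlocalGame.equivQut_gen (hG : G.IsBisynchronous) (he : Equivalence (OrbitalRel G.gen))
    (x a : W) : equivQut hG he (G.gen x a) = (orbitalGraph G.gen).qutGen x a :=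
  toQut_gen he x a

end Orbital

/-- Transport of a comultiplication along an isomorphism. -/
theorem IsMatrixComultiplication.exists_transport {W : Type u} [Fintype W] {A B : Type u}
    [CStarAlgebra A] [CStarAlgebra B] {u : W → W → A} {v : W → W → B}
    {Δ : A →⋆ₐ[ℂ] MinTensor A A} (hΔ : IsMatrixComultiplication u Δ) (f : A →⋆ₐ[ℂ] B)
    (g : B →⋆ₐ[ℂ] A) (hgf : ∀ z, g (f z) = z) (hf : ∀ x a, f (u x a) = v x a) :
    ∃ Δ' : B →⋆ₐ[ℂ] MinTensor B B, IsMatrixComultiplication v Δ' ∧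
      ∀ z, MinTensor.map f f (Δ z) = Δ' (f z) := by
  refine ⟨((MinTensor.map f f).comp Δ).comp g, fun x a => ?_, fun z => ?_⟩
  · rw [← hf]
    change MinTensor.map f f (Δ (g (f (u x a)))) = _
    rw [hgf, hΔ, map_sum]
    refine Finset.sum_congr rfl fun r _ => ?_
    rw [MinTensor.map_tmul, hf, hf]
  · exact congrArg (fun w => MinTensor.map f f (Δ w)) (hgf z).symm

end

/-! ### The main theorem -/

theorem mainTheorem12 {W : Type u} [Fintype W] [DecidableEq W] [Nonempty W]
    (G : NonlocalGame W W W W) (hbisync : G.IsBisynchronous) (htrans : G.IsTransitive)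
    (hq : G.HasPerfectQuantumStrategy) :
    Equivalence (OrbitalRel G.gen) ∧
    ∃ (Δ : G.CStar →⋆ₐ[ℂ] MinTensor G.CStar G.CStar)
      (Δ' : (orbitalGraph G.gen).Qut →⋆ₐ[ℂ]
        MinTensor (orbitalGraph G.gen).Qut (orbitalGraph G.gen).Qut)
      (φ : G.CStar ≃⋆ₐ[ℂ] (orbitalGraph G.gen).Qut),
      IsMatrixComultiplication G.gen Δ ∧ IsCompactQuantumGroup Δ ∧
      IsMatrixComultiplication (orbitalGraph G.gen).qutGen Δ' ∧ IsCompactQuantumGroup Δ' ∧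
      (∀ x a, φ (G.gen x a) = (orbitalGraph G.gen).qutGen x a) ∧
      ∀ z, MinTensor.map (φ : G.CStar →⋆ₐ[ℂ] (orbitalGraph G.gen).Qut) φ (Δ z) = Δ' (φ z) := by
  have := NonlocalGame.nontrivial_cstar hbisync.1 hq
  have hu := G.relations_gen.isMagicUnitary hbisync
  have hΔ := G.isMatrixComultiplication_comul hbisync.1 htrans
  have he : Equivalence (OrbitalRel G.gen) := hu.orbitalRel_equivalence fun _ _ _ =>
    hu.orbitalRel_trans G.cstarRelations.isNormedByReps hΔ
  have hv := (orbitalGraph G.gen).relations_qutGen.isMagicUnitary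
  obtain ⟨Δ', hΔ', h⟩ := hΔ.exists_transport
    (NonlocalGame.equivQut hbisync he : G.CStar →⋆ₐ[ℂ] (orbitalGraph G.gen).Qut)
    (NonlocalGame.ofQut hbisync he) (NonlocalGame.equivQut hbisync he).symm_apply_apply
    (NonlocalGame.equivQut_gen hbisync he)
  exact ⟨he, _, Δ', _, hΔ, hu.isCompactQuantumGroup (G.cstarRelations.topologicallyGenerates_gen
    fun p => (hu.proj p.1 p.2).isSelfAdjoint) hΔ, hΔ', hv.isCompactQuantumGroup
    ((orbitalGraph G.gen).cstarRelations.topologicallyGenerates_gen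
    fun p => (hv.proj p.1 p.2).isSelfAdjoint) hΔ', NonlocalGame.equivQut_gen hbisync he, h⟩
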